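/- **Theorem 2.2.** Let $(\mathcal Y,d_{\mathcal Y})$ be a separable metric space with its Borel $\sigma$-field and $\mathcal X=\{1,\dots,S\}$. Let $(X_t,Y_t)_{t\ge1}$ be a hidden Markov model with parameter $\theta$: $(X_t)$ is a Markov chain on $\mathcal X$ with transition matrix $Q_\theta$ and a stationary initial distribution $r_\theta$; given $(X_t)$, the $Y_t\in\mathcal Y$ are independent, and $Y_t$ has density $g_\theta(\cdot\mid X_t)$ with respect to a fixed $\sigma$-finite measure $\mu$ on $\mathcal Y$. Write $\mathbb P_\theta(Y_1\in\cdot\mid X_1=a)=g_\theta(\cdot\mid a)\,d\mu$ for the emission distributions, $\mathbb P^{(n)}_\theta$ for the law of $Y_1^n=(Y_1,\dots,Y_n)$ on $\mathcal Y^n$, and $d_{\ell_1}(u,v)=\sum_{i=1}^n d_{\mathcal Y}(u_i,v_i)$. For a metric $d$ on $E$ let $W_1^d(\rho,\nu)=\inf_\pi\int d(u,v)\,\pi(du,dv)$ over all couplings $\pi$ of $\rho$ and $\nu$. A probability measure $\rho$ on $E$ satisfies $T_1(C)$, where $C>0$, if $W_1^d(\rho,\nu)\le\sqrt{2C\,H(\nu\mid\rho)}$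 for every probability measure $\nu$ on $E$, where $H$ is the Kullback–Leibler divergence. Suppose that for some integer $r>0$ all entries of $Q_\theta^r$ are positive. Then $$D_\theta=\frac12\sum_{t=1}^\infty\ \sup_{a,a'\in\mathcal X}\ \sum_{b\in\mathcal X}\bigl|Q_\theta^t(a,b)-Q_\theta^t(a',b)\bigr|<\infty ,$$ and, for every $n\ge1$, $\mathbb P^{(n)}_\theta$ satisfies $T_1(nC_H^\theta)$ on $(\mathcal Y^n,d_{\ell_1})$ in each of the following cases. 1. $\mathcal Y$ is countable and $d_{\mathcal Y}\le 1$ (for example, $d_{\mathcal Y}$ is the discrete metric $1_{y\ne y'}$, so that $d_{\ell_1}$ is the Hamming metric); here $C_H^\theta=(D_\theta+1)^2$. 2. $\mathcal Y$ is arbitrary (in particular, it may be uncountable), and there are constants $C_{\mathcal Y}>0$ and $L>0$ such that, for all $a,b\in\mathcal X$, the emission distribution $\mathbb P_\theta(Y_1\in\cdot\mid X_1=a)$ satisfies $T_1(C_{\mathcal Y})$ on $(\mathcal Y,d_{\mathcal Y})$ and $$W_1^{d_{\mathcal Y}}\bigl\{\mathbb P_\theta(Y_1\in\cdot\mid X_1=a),\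 \mathbb P_\theta(Y_1\in\cdot\mid X_1=b)\bigr\}\le L\,1_{a\ne b};$$ here $C_H^\theta=C_{\mathcal Y}+L^2(D_\theta+1)^2$. -/

import Mathlib

open MeasureTheory InformationTheory
open scoped ENNReal NNReal

noncomputable section

/-- The couplings of `μ` and `ν`: measures on the product with marginals `μ` and `ν`. -/
def couplings {E : Type*} [MeasurableSpace E] (μ ν : Measure E) : Set (Measure (E × E)) :=
  {π | π.map Prod.fst = μ ∧ π.map Prod.snd = ν}

/-- The optimal transportation cost `W₁^d(μ, ν)` with cost function `d`. -/
def transportCost {E : Type*} [MeasurableSpace E] (d : E → E → ℝ) (μ ν : Measure E) : ℝ≥0∞ :=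
  ⨅ π ∈ couplings μ ν, ∫⁻ p, ENNReal.ofReal (d p.1 p.2) ∂π

/-- The `L¹`-transportation cost information inequality `μ ∈ T₁(C)` with respect to `d`:
`C > 0` and `W₁^d(μ, ν) ≤ √(2 C H(ν | μ))` for every probability measure `ν`, where `H` is the
Kullback-Leibler divergence (equal to `∞` if `ν` is not absolutely continuous). -/
def SatisfiesT1 {E : Type*} [MeasurableSpace E] (d : E → E → ℝ) (C : ℝ) (μ : Measure E) : Prop :=
  0 < C ∧ ∀ ν : Measure E, IsProbabilityMeasure ν →
    transportCost d μ ν ≤ (2 * ENNReal.ofReal C * klDiv ν μ) ^ (1 / 2 : ℝ)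

/-- The `ℓ¹`-metric on `E ^ n`. -/
def l1Dist {E : Type*} [MetricSpace E] {n : ℕ} (u v : Fin n → E) : ℝ :=
  ∑ i, dist (u i) (v i)

/-- The parameters of a hidden Markov model with hidden state space of size `S` and observation
space `𝓨`: a transition matrix `Q`, a stationary initial distribution `init`, a `σ`-finite
reference measure `μ` on `𝓨`, and emission densities `g a` with respect to `μ`. -/
structure HMMParam (S : ℕ) (𝓨 : Type*) [MeasurableSpace 𝓨] where
  Q : Matrix (Fin S) (Fin S) ℝ
  Q_nonneg : ∀ a b, 0 ≤ Q a b
  Q_sum : ∀ a, ∑ b, Q a b = 1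
  init : Fin S → ℝ
  init_nonneg : ∀ a, 0 ≤ init a
  init_sum : ∑ a, init a = 1
  init_stationary : ∀ b, ∑ a, init a * Q a b = init b
  μ : Measure 𝓨
  sigmaFinite_μ : SigmaFinite μ
  g : Fin S → 𝓨 → ℝ≥0
  measurable_g : ∀ a, Measurable (g a)
  lintegral_g : ∀ a, ∫⁻ y, (g a y : ℝ≥0∞) ∂μ = 1

namespace HMMParam

variable {S : ℕ} {𝓨 : Type*} [MeasurableSpace 𝓨]

/-- The emission distribution of the hidden state `a`, i.e. the law of `Y₁` given `X₁ = a`. -/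
def emission (M : HMMParam S 𝓨) (a : Fin S) : Measure 𝓨 :=
  M.μ.withDensity fun y => (M.g a y : ℝ≥0∞)

/-- The mixing constant `D = ½ ∑_{t ≥ 1} sup_{a, a'} ∑_b |Q^t(a, b) - Q^t(a', b)|`, as an extended
nonnegative number. -/
def mixingConst (M : HMMParam S 𝓨) : ℝ≥0∞ :=
  (1 / 2) * ∑' t : ℕ, ⨆ (a : Fin S) (a' : Fin S),
    ENNReal.ofReal (∑ b, |(M.Q ^ (t + 1)) a b - (M.Q ^ (t + 1)) a' b|)

/-- `(X, Y)` is, under `P`, a hidden Markov model with parameters `M`: the hidden chain `X` is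
Markov with initial distribution `init` and transition matrix `Q`, and given `X` the observations
are independent, `Y k` having density `g (X k)` with respect to `μ`. This is expressed through the
finite-dimensional distributions. Time is shifted by one: `X k`, `Y k` stand for `X_{k+1}`,
`Y_{k+1}`. -/
structure IsHMM (M : HMMParam S 𝓨) {Ω : Type*} [MeasurableSpace Ω] (P : Measure Ω)
    (X : ℕ → Ω → Fin S) (Y : ℕ → Ω → 𝓨) : Prop where
  measurable_X : ∀ k, Measurable (X k)
  measurable_Y : ∀ k, Measurable (Y k)
  law : ∀ (n : ℕ) (x : ℕ → Fin S) (A : ℕ → Set 𝓨), (∀ k, MeasurableSet (A k)) →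
    P {ω | ∀ k ≤ n, X k ω = x k ∧ Y k ω ∈ A k} =
      ENNReal.ofReal (M.init (x 0) * ∏ k ∈ Finset.range n, M.Q (x k) (x (k + 1))) *
        ∏ k ∈ Finset.range (n + 1), ∫⁻ y in A k, (M.g (x k) y : ℝ≥0∞) ∂M.μ

end HMMParam

end

/-!
The proof goes through the Bobkov–Götze characterization: `T₁(C)` is equivalent to the sub-Gaussian
bound `∫ exp f ≤ exp (∫ f + C K² / 2)` for every bounded `K`-Lipschitz `f` (`LipSubgaussian`).
One direction applies `T₁` to the exponentially tilted measure (`SatisfiesT1.lipSubgaussian`); the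
other one combines the Donsker–Varadhan inequality (`integral_le_toReal_klDiv_add_log`) with
Kantorovich–Rubinstein duality (`LipSubgaussian.satisfiesT1`). As the observation space is only
separable, measures on it need not be tight, and duality is obtained by quantization
(`transportCost_le_of_forall_bounded_lipschitz`): both measures are moved to finitely many points,
where duality is a separation theorem in finite dimension, and an optimal finite coupling is lifted
back fibrewise. No optimal coupling has to exist in the limit, because the cost is an infimum.

In its sub-Gaussian form the inequality is proved for the law of `(Y₁, …, Yₙ)`, which is the mixture
over hidden paths `x` of the products of the emission laws of the `xᵢ`. Let `f` be `K`-Lipschitz for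
the `ℓ¹`-metric. Given the path, the product measure is sub-Gaussian with constant `n C_Y`
(`LipSubgaussian.pi`). The conditional mean `F x` of `f` changes by at most `K L` when one
coordinate of `x` changes (`abs_integral_pi_sub_integral_pi_le`). It then remains to bound the
exponential moment of a Hamming-Lipschitz function of a Markov path. Hoeffding's lemma is applied at
each step; the conditional mean of the future, as a function of the current state, oscillates by at
most `K L (1 + 2 D)`, by replacing the coordinates of the path by a fixed state one at a time
(`abs_sum_mul_pathMean_le`). This gives the constant `n (C_Y + L² (1 + 2 D)² / 4)`, which is below
`n (C_Y + L² (D + 1)²)`. When `dist ≤ 1`, every emission law is sub-Gaussian with constant `1 / 4`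
and `L = 1` is admissible, and `1 / 4 + (1 + 2 D)² / 4 ≤ (D + 1)²`.

Finiteness of `D` is Doeblin's contraction: if `Q ^ r ≥ δ > 0` entrywise, then `Q ^ r` contracts the
`ℓ¹`-norm on vectors of sum zero by the factor `1 - S δ` (`sum_abs_vecMul_le`).
-/

/-! ### Bounded Lipschitz functions -/

theorem measurable_of_abs_sub_le {E : Type*} [PseudoMetricSpace E] [MeasurableSpace E]
    [BorelSpace E] {f : E → ℝ} {K : ℝ} (hf : ∀ u v, |f u - f v| ≤ K * dist u v) :
    Measurable f := by
  refine (LipschitzWith.of_dist_le_mul (K := K.toNNReal) fun u v => ?_).continuous.measurable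
  rw [Real.dist_eq]
  refine (hf u v).trans ?_
  gcongr
  exact Real.le_coe_toNNReal K

theorem integrable_of_abs_le {E : Type*} [MeasurableSpace E] {ρ : Measure E}
    [IsFiniteMeasure ρ] {f : E → ℝ} (hf : Measurable f) (hb : ∃ b, ∀ u, |f u| ≤ b) :
    Integrable f ρ := by
  obtain ⟨b, hb⟩ := hb
  exact Integrable.of_bound hf.aestronglyMeasurable b (ae_of_all _ hb)

theorem exists_abs_exp_le {E : Type*} {f : E → ℝ} (hb : ∃ b, ∀ u, |f u| ≤ b) :
    ∃ b, ∀ u, |Real.exp (f u)| ≤ b := by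
  obtain ⟨b, hb⟩ := hb
  refine ⟨Real.exp b, fun u => ?_⟩
  rw [abs_of_pos (Real.exp_pos _)]
  exact Real.exp_le_exp.2 ((le_abs_self _).trans (hb u))

theorem abs_integral_sub_integral_le {E : Type*} [MeasurableSpace E] {ρ : Measure E}
    [IsProbabilityMeasure ρ] {f g : E → ℝ} (hf : Integrable f ρ) (hg : Integrable g ρ) {c : ℝ}
    (h : ∀ x, |f x - g x| ≤ c) : |∫ x, f x ∂ρ - ∫ x, g x ∂ρ| ≤ c := by
  rw [← integral_sub hf hg]
  simpa using norm_integral_le_of_norm_le_const (μ := ρ)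
    (ae_of_all _ fun x => (Real.norm_eq_abs _).trans_le (h x))

theorem abs_integral_le {E : Type*} [MeasurableSpace E] {ρ : Measure E}
    [IsProbabilityMeasure ρ] {f : E → ℝ} {c : ℝ}
    (h : ∀ x, |f x| ≤ c) : |∫ x, f x ∂ρ| ≤ c := by
  simpa using norm_integral_le_of_norm_le_const (μ := ρ)
    (ae_of_all _ fun x => (Real.norm_eq_abs _).trans_le (h x))

/-! ### Kantorovich–Rubinstein duality on separable metric spaces -/

/-- Duality for the finite transportation problem: an upper bound for the dual values bounds the
cost of some coupling. The triples (first marginal, second marginal, cost) of probability weights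
form a compact convex set, which can be separated from `{p} × {q} × (-∞, B]` if it
misses that set. -/
theorem exists_finite_coupling_of_dual_bound {I J : Type*} [Fintype I] [Fintype J]
    (c : I → J → ℝ) {p : I → ℝ} {q : J → ℝ} (hp : ∀ i, 0 ≤ p i) (hq : ∀ j, 0 ≤ q j)
    (hp1 : ∑ i, p i = 1) (hq1 : ∑ j, q j = 1) {B : ℝ}
    (h : ∀ (φ : I → ℝ) (ψ : J → ℝ), (∀ i j, φ i + ψ j ≤ c i j) →
      ∑ i, φ i * p i + ∑ j, ψ j * q j ≤ B) :
    ∃ w : I → J → ℝ, (∀ i j, 0 ≤ w i j) ∧ (∀ i, ∑ j, w i j = p i) ∧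
      (∀ j, ∑ i, w i j = q j) ∧ ∑ i, ∑ j, c i j * w i j ≤ B := by
  classical
  let Φ : (I × J → ℝ) →ₗ[ℝ] (I → ℝ) × (J → ℝ) × ℝ :=
    { toFun := fun w => (fun i => ∑ j, w (i, j), fun j => ∑ i, w (i, j),
        ∑ i, ∑ j, c i j * w (i, j))
      map_add' := fun w w' => by
        ext <;> simp [Finset.sum_add_distrib, mul_add]
      map_smul' := fun a w => by
        ext <;> simp [Finset.mul_sum, mul_left_comm] }
  by_contra hcon
  have hdisj : Disjoint (Φ '' stdSimplex ℝ (I × J))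
      ({p} ×ˢ ({q} ×ˢ Set.Iic B) : Set ((I → ℝ) × (J → ℝ) × ℝ)) := by
    rw [Set.disjoint_left]
    rintro _ ⟨w, hw, rfl⟩ ⟨h1, h2, h3⟩
    exact hcon ⟨fun i j => w (i, j), fun i j => hw.1 _, fun i => congrFun h1 i,
      fun j => congrFun h2 j, h3⟩
  obtain ⟨f, u, v, hfs, huv, hft⟩ := geometric_hahn_banach_compact_closed
    ((convex_stdSimplex ℝ (I × J)).linear_image Φ)
    ((isCompact_stdSimplex ℝ (I × J)).image Φ.continuous_of_finiteDimensional)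
    ((convex_singleton p).prod ((convex_singleton q).prod (convex_Iic B)))
    (isClosed_singleton.prod (isClosed_singleton.prod isClosed_Iic)) hdisj
  let φ : I → ℝ := fun i => f (Pi.single i 1, 0, 0)
  let ψ : J → ℝ := fun j => f (0, Pi.single j 1, 0)
  let γ : ℝ := f (0, 0, 1)
  have hf : ∀ a b s, f (a, b, s) = ∑ i, φ i * a i + ∑ j, ψ j * b j + γ * s := by
    intro a b s
    have e : ((a, b, s) : (I → ℝ) × (J → ℝ) × ℝ) =
        ∑ i, a i • (Pi.single i 1, 0, 0) + ∑ j, b j • (0, Pi.single j 1, 0) +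
          s • (0, 0, 1) := by
      ext k
      · simp [Prod.fst_sum, Finset.sum_apply, Pi.single_apply]
      · simp [Prod.fst_sum, Prod.snd_sum, Finset.sum_apply, Pi.single_apply]
      · simp [Prod.snd_sum]
    rw [e]
    simp only [map_add, map_sum, map_smul, smul_eq_mul, φ, ψ, γ]
    simp only [mul_comm]
  have hst : ∀ i j, φ i + ψ j + γ * c i j < u := by
    intro i j
    have := hfs _ ⟨Pi.single (i, j) 1, single_mem_stdSimplex ℝ (i, j), rfl⟩
    simp only [Φ, LinearMap.coe_mk, AddHom.coe_mk] at this
    rw [hf] at this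
    convert this using 1
    simp [Pi.single_apply, Prod.ext_iff, ite_and]
  have hpt : ∀ s ≤ B, u < ∑ i, φ i * p i + ∑ j, ψ j * q j + γ * s := fun s hs => by
    rw [← hf]; exact huv.trans (hft _ ⟨rfl, rfl, hs⟩)
  -- The separating functional stays bounded below as `s → -∞`.
  have hγ : γ ≤ 0 := by
    by_contra hγ
    push Not at hγ
    set R := ∑ i, φ i * p i + ∑ j, ψ j * q j
    have h1 := hpt (min B ((u - R) / γ)) (min_le_left _ _)
    have h2 : γ * min B ((u - R) / γ) ≤ u - R := by
      calc _ ≤ γ * ((u - R) / γ) := by gcongr; exact min_le_right _ _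
        _ = _ := by field_simp
    linarith
  have hB := hpt B le_rfl
  -- If `γ = 0`, the cost plays no role and testing on the product coupling is contradictory.
  rcases hγ.lt_or_eq with hγ | hγ
  · have := h (fun i => (φ i - u) / (-γ)) (fun j => ψ j / (-γ)) fun i j => by
      rw [← add_div, div_le_iff₀ (by linarith)]
      linarith [hst i j]
    simp only [div_mul_eq_mul_div, ← Finset.sum_div, ← add_div] at this
    rw [div_le_iff₀ (by linarith)] at this
    simp only [sub_mul, Finset.sum_sub_distrib, ← Finset.mul_sum, hp1] at this
    linarith
  · have h1 : ∑ i, ∑ j, (φ i + ψ j - u) * (p i * q j) ≤ 0 :=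
      Finset.sum_nonpos fun i _ => Finset.sum_nonpos fun j _ =>
        mul_nonpos_of_nonpos_of_nonneg (by have := hst i j; rw [hγ] at this; linarith)
          (mul_nonneg (hp i) (hq j))
    have h2 : ∑ i, ∑ j, (φ i + ψ j - u) * (p i * q j) =
        (∑ i, φ i * p i) * ∑ j, q j + (∑ i, p i) * (∑ j, ψ j * q j)
          - u * ((∑ i, p i) * ∑ j, q j) := by
      simp only [Finset.sum_mul_sum]
      simp only [Finset.mul_sum, ← Finset.sum_add_distrib, ← Finset.sum_sub_distrib]
      exact Finset.sum_congr rfl fun i _ => Finset.sum_congr rfl fun j _ => by ring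
    rw [hp1, hq1] at h2
    rw [hγ] at hB
    linarith

/-- A coupling `w` of the images of `ρ` and `ν` under a finite-valued map `T` lifts to a coupling of
`ρ` and `ν`: given the pair of fibres, the two points are drawn independently from the conditional
laws. -/
theorem exists_coupling_of_finite_coupling {E I : Type*} [MeasurableSpace E] [Fintype I]
    {ρ ν : Measure E} [IsProbabilityMeasure ρ] [IsProbabilityMeasure ν] {T : E → I}
    (hT : ∀ i, MeasurableSet (T ⁻¹' {i})) {w : I → I → ℝ≥0∞}
    (h1 : ∀ i, ∑ j, w i j = ρ (T ⁻¹' {i})) (h2 : ∀ j, ∑ i, w i j = ν (T ⁻¹' {j})) :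
    ∃ π ∈ couplings ρ ν, ∀ c : I → I → ℝ≥0∞,
      ∫⁻ z, c (T z.1) (T z.2) ∂π ≤ ∑ i, ∑ j, c i j * w i j := by
  classical
  have hsum : ∀ (κ : Measure E), ∑ i, κ.restrict (T ⁻¹' {i}) = κ := fun κ => by
    ext s hs
    simp only [Measure.finsetSum_apply, Measure.restrict_apply hs]
    rw [← measure_biUnion_finset]
    · congr 1; ext x; simp
    · intro i _ j _ hij
      refine Set.disjoint_left.2 fun x hx hx' => hij ?_
      exact hx.2.symm.trans hx'.2
    · exact fun i _ => hs.inter (hT i)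
  have hw1 : ∀ i j, ρ (T ⁻¹' {i}) = 0 → w i j = 0 := fun i j h => by
    have := (h1 i).trans h
    exact (Finset.sum_eq_zero_iff.1 this) j (Finset.mem_univ _)
  have hw2 : ∀ i j, ν (T ⁻¹' {j}) = 0 → w i j = 0 := fun i j h => by
    have := (h2 j).trans h
    exact (Finset.sum_eq_zero_iff.1 this) i (Finset.mem_univ _)
  -- The inverses below are those of possibly null fibres; `w` vanishes there.
  have hcan1 : ∀ i j, w i j * ((ρ (T ⁻¹' {i}))⁻¹ * ρ (T ⁻¹' {i})) = w i j := fun i j => by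
    by_cases h : ρ (T ⁻¹' {i}) = 0
    · simp [hw1 i j h]
    · rw [ENNReal.inv_mul_cancel h (measure_ne_top _ _), mul_one]
  have hcan2 : ∀ i j, w i j * ((ν (T ⁻¹' {j}))⁻¹ * ν (T ⁻¹' {j})) = w i j := fun i j => by
    by_cases h : ν (T ⁻¹' {j}) = 0
    · simp [hw2 i j h]
    · rw [ENNReal.inv_mul_cancel h (measure_ne_top _ _), mul_one]
  let m : I → I → Measure (E × E) := fun i j =>
    (w i j * ((ρ (T ⁻¹' {i}))⁻¹ * (ν (T ⁻¹' {j}))⁻¹)) •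
      ((ρ.restrict (T ⁻¹' {i})).prod (ν.restrict (T ⁻¹' {j})))
  refine ⟨∑ i, ∑ j, m i j, ⟨?_, ?_⟩, fun c => ?_⟩
  · calc (∑ i, ∑ j, m i j).map Prod.fst
        = ∑ i, ∑ j, (w i j * (ρ (T ⁻¹' {i}))⁻¹) • ρ.restrict (T ⁻¹' {i}) := by
          ext s hs
          rw [Measure.map_apply measurable_fst hs]
          simp only [Measure.finsetSum_apply, Measure.smul_apply, m, smul_eq_mul]
          refine Finset.sum_congr rfl fun i _ => Finset.sum_congr rfl fun j _ => ?_
          rw [← Set.prod_univ, Measure.prod_prod, Measure.restrict_apply_univ]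
          by_cases h : ν (T ⁻¹' {j}) = 0
          · simp [hw2 i j h]
          · calc _ = w i j * (ρ (T ⁻¹' {i}))⁻¹ * (ρ.restrict (T ⁻¹' {i})) s *
                  ((ν (T ⁻¹' {j}))⁻¹ * ν (T ⁻¹' {j})) := by ring
              _ = _ := by rw [ENNReal.inv_mul_cancel h (measure_ne_top _ _)]; ring
      _ = ∑ i, ρ.restrict (T ⁻¹' {i}) := by
          refine Finset.sum_congr rfl fun i _ => ?_
          rw [← Finset.sum_smul, ← Finset.sum_mul, h1]
          by_cases h : ρ (T ⁻¹' {i}) = 0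
          · simp [Measure.restrict_eq_zero.2 h]
          · rw [ENNReal.mul_inv_cancel h (measure_ne_top _ _), one_smul]
      _ = ρ := hsum ρ
  · calc (∑ i, ∑ j, m i j).map Prod.snd
        = ∑ i, ∑ j, (w i j * (ν (T ⁻¹' {j}))⁻¹) • ν.restrict (T ⁻¹' {j}) := by
          ext s hs
          rw [Measure.map_apply measurable_snd hs]
          simp only [Measure.finsetSum_apply, Measure.smul_apply, m, smul_eq_mul]
          refine Finset.sum_congr rfl fun i _ => Finset.sum_congr rfl fun j _ => ?_
          rw [← Set.univ_prod, Measure.prod_prod, Measure.restrict_apply_univ]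
          by_cases h : ρ (T ⁻¹' {i}) = 0
          · simp [hw1 i j h]
          · calc _ = w i j * (ν (T ⁻¹' {j}))⁻¹ * (ν.restrict (T ⁻¹' {j})) s *
                  ((ρ (T ⁻¹' {i}))⁻¹ * ρ (T ⁻¹' {i})) := by ring
              _ = _ := by rw [ENNReal.inv_mul_cancel h (measure_ne_top _ _)]; ring
      _ = ∑ j, ν.restrict (T ⁻¹' {j}) := by
          rw [Finset.sum_comm]
          refine Finset.sum_congr rfl fun j _ => ?_
          rw [← Finset.sum_smul, ← Finset.sum_mul, h2]
          by_cases h : ν (T ⁻¹' {j}) = 0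
          · simp [Measure.restrict_eq_zero.2 h]
          · rw [ENNReal.mul_inv_cancel h (measure_ne_top _ _), one_smul]
      _ = ν := hsum ν
  · simp only [lintegral_finsetSum_measure, m, lintegral_smul_measure, smul_eq_mul]
    refine Finset.sum_le_sum fun i _ => Finset.sum_le_sum fun j _ => ?_
    rw [Measure.prod_restrict, setLIntegral_congr_fun (g := fun _ => c i j)
      ((hT i).prod (hT j))]
    · rw [setLIntegral_const, Measure.prod_prod]
      apply le_of_eq
      calc _ = c i j * (w i j * ((ρ (T ⁻¹' {i}))⁻¹ * ρ (T ⁻¹' {i})) *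
              ((ν (T ⁻¹' {j}))⁻¹ * ν (T ⁻¹' {j}))) := by ring
        _ = _ := by rw [hcan1, hcan2]
    · rintro ⟨x, y⟩ ⟨hx, hy⟩
      simp only [Set.mem_preimage, Set.mem_singleton_iff] at hx hy
      simp [hx, hy]

/-- A dual pair `(φ, ψ)` for the cost `d` on finitely many points is dominated by a pair `(f, -f)`,
where `f` is bounded and `1`-Lipschitz on the whole space: `f` is the `c`-transform of `ψ`,
truncated. -/
theorem exists_bounded_lipschitz_of_dual {E I : Type*} [Fintype I] [Nonempty I]
    {d : E → E → ℝ} (hself : ∀ x, d x x = 0) (hsymm : ∀ x y, d x y = d y x)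
    (htri : ∀ x y z, d x z ≤ d x y + d y z) (x : I → E) {φ ψ : I → ℝ}
    (h : ∀ i j, φ i + ψ j ≤ d (x i) (x j)) :
    ∃ f : E → ℝ, (∀ u v, |f u - f v| ≤ d u v) ∧ (∃ b, ∀ u, |f u| ≤ b) ∧
      (∀ i, φ i ≤ f (x i)) ∧ ∀ j, ψ j ≤ -f (x j) := by
  let f : E → ℝ := fun u => Finset.univ.inf' Finset.univ_nonempty fun j => d u (x j) - ψ j
  have hle : ∀ u v, f u ≤ f v + d u v := fun u v => by
    obtain ⟨j, -, hj⟩ := Finset.exists_mem_eq_inf' Finset.univ_nonempty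
      fun j => d v (x j) - ψ j
    have h1 : f u ≤ d u (x j) - ψ j := Finset.inf'_le _ (Finset.mem_univ j)
    have h2 : f v = d v (x j) - ψ j := hj
    linarith [htri u v (x j)]
  let m : ℝ := ∑ i, |f (x i)|
  have hm : ∀ i, |f (x i)| ≤ m := fun i =>
    Finset.single_le_sum (f := fun i => |f (x i)|) (fun _ _ => abs_nonneg _) (Finset.mem_univ i)
  have hm0 : 0 ≤ m := Finset.sum_nonneg fun _ _ => abs_nonneg _
  -- Truncation at `±m` leaves `f` unchanged at the points `x i`.
  have hg : ∀ i, max (-m) (min m (f (x i))) = f (x i) := fun i => by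
    have := abs_le.1 (hm i)
    rw [min_eq_right this.2, max_eq_right this.1]
  refine ⟨fun u => max (-m) (min m (f u)), fun u v => ?_, ⟨m, fun u => ?_⟩, fun i => ?_,
    fun j => ?_⟩
  · have h1 := hle u v
    have h2 := hle v u
    rw [hsymm v u] at h2
    rw [abs_le]
    constructor <;>
      rcases max_cases (-m) (min m (f u)) with h | h <;>
      rcases max_cases (-m) (min m (f v)) with h' | h' <;>
      rcases min_cases m (f u) with h'' | h'' <;>
      rcases min_cases m (f v) with h''' | h''' <;> linarith
  · exact abs_le.2 ⟨le_max_left _ _, max_le (by linarith) (min_le_left _ _)⟩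
  · simp only [hg]
    exact Finset.le_inf' _ _ fun j _ => by linarith [h i j]
  · simp only [hg]
    have : f (x j) ≤ d (x j) (x j) - ψ j := Finset.inf'_le _ (Finset.mem_univ j)
    linarith [hself (x j)]

open Filter Topology in
/-- The hard half of Kantorovich–Rubinstein duality, without completeness or tightness. Here `d` is
a continuous pseudometric dominated by a multiple of the metric of `E`; the latter is used only to
quantize the space. -/
theorem transportCost_le_of_forall_bounded_lipschitz {E : Type*} [MetricSpace E]
    [TopologicalSpace.SeparableSpace E] [MeasurableSpace E] [BorelSpace E]
    {d : E → E → ℝ} (hself : ∀ x, d x x = 0) (hsymm : ∀ x y, d x y = d y x)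
    (htri : ∀ x y z, d x z ≤ d x y + d y z) (hcont : Continuous fun z : E × E => d z.1 z.2)
    {K : ℝ} (hK : ∀ x y, d x y ≤ K * dist x y)
    {ρ ν : Measure E} [IsProbabilityMeasure ρ] [IsProbabilityMeasure ν]
    (hρ : ∀ x₀, Integrable (fun x => dist x₀ x) ρ) (hν : ∀ x₀, Integrable (fun x => dist x₀ x) ν)
    {B : ℝ} (h : ∀ f : E → ℝ, (∀ u v, |f u - f v| ≤ d u v) → (∃ b, ∀ u, |f u| ≤ b) →
      ∫ x, f x ∂ρ - ∫ x, f x ∂ν ≤ B) :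
    transportCost d ρ ν ≤ ENNReal.ofReal B := by
  have : Nonempty E := ρ.nonempty_of_neZero
  have : SecondCountableTopology E := UniformSpace.secondCountable_of_separable E
  have hnn : ∀ x y, 0 ≤ d x y := fun x y => by
    linarith [htri x y x, hself x, hsymm x y]
  let e := TopologicalSpace.denseSeq E
  let T : ℕ → SimpleFunc E E := SimpleFunc.nearestPt e
  -- The nearest point is at least as near as `e 0`, which gives a dominating function.
  have hKe : ∀ x N, d x (T N x) ≤ |K| * dist (e 0) x := fun x N => by
    have h1 := SimpleFunc.edist_nearestPt_le e x (Nat.zero_le N)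
    rw [edist_dist, edist_dist, ENNReal.ofReal_le_ofReal_iff dist_nonneg, dist_comm] at h1
    calc _ ≤ K * dist x (T N x) := hK _ _
      _ ≤ |K| * dist x (T N x) := by gcongr; exact le_abs_self K
      _ ≤ _ := by gcongr
  have hmeas : ∀ N, Measurable fun x => d x (T N x) := fun N =>
    hcont.measurable.comp (measurable_id.prodMk (T N).measurable)
  have hint : ∀ (κ : Measure E), (∀ x₀, Integrable (fun x => dist x₀ x) κ) → ∀ N,
      Integrable (fun x => d x (T N x)) κ := fun κ hκ N =>
    ((hκ (e 0)).const_mul |K|).mono' (hmeas N).aestronglyMeasurable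
      (ae_of_all _ fun x => by rw [Real.norm_of_nonneg (hnn _ _)]; exact hKe x N)
  have hlim : ∀ (κ : Measure E), (∀ x₀, Integrable (fun x => dist x₀ x) κ) →
      Tendsto (fun N => ∫ x, d x (T N x) ∂κ) atTop (𝓝 0) := fun κ hκ => by
    rw [show (0 : ℝ) = ∫ x, (0 : ℝ) ∂κ by simp]
    refine tendsto_integral_of_dominated_convergence (fun x => |K| * dist (e 0) x)
      (fun N => (hmeas N).aestronglyMeasurable) ((hκ (e 0)).const_mul |K|)
      (fun N => ae_of_all _ fun x => by rw [Real.norm_of_nonneg (hnn _ _)]; exact hKe x N)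
      (ae_of_all _ fun x => ?_)
    have h1 : Tendsto (fun N => T N x) atTop (𝓝 x) :=
      SimpleFunc.tendsto_nearestPt (TopologicalSpace.denseRange_denseSeq E x)
    have h2 := (hcont.tendsto (x, x)).comp (tendsto_const_nhds.prodMk_nhds h1)
    simpa [Function.comp_def, hself] using h2
  have key : ∀ N, transportCost d ρ ν ≤ ENNReal.ofReal
      (B + (∫ x, d x (T N x) ∂ρ + ∫ x, d x (T N x) ∂ν) +
        (∫ x, d x (T N x) ∂ρ + ∫ x, d x (T N x) ∂ν)) := fun N => by
    set a := ∫ x, d x (T N x) ∂ρ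
    set b := ∫ x, d x (T N x) ∂ν
    let I := (T N).range
    let S : E → I := fun x => ⟨T N x, SimpleFunc.mem_range_self _ _⟩
    have hS : Measurable S := (T N).measurable.subtype_mk
    have : Nonempty I := ⟨S (e 0)⟩
    have hSfib : ∀ i, MeasurableSet (S ⁻¹' {i}) := fun i => hS (measurableSet_singleton i)
    have hsumint : ∀ (κ : Measure E) [IsProbabilityMeasure κ] (f : E → ℝ),
        ∑ i : I, f i * κ.real (S ⁻¹' {i}) = ∫ x, f (T N x) ∂κ := fun κ _ f => by
      have h1 : ∫ x, f (T N x) ∂κ = ∫ i : I, f i ∂(κ.map S) := by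
        rw [integral_map hS.aemeasurable (Measurable.of_discrete).aestronglyMeasurable]
      have : IsProbabilityMeasure (κ.map S) := Measure.isProbabilityMeasure_map hS.aemeasurable
      rw [h1, integral_fintype Integrable.of_finite]
      refine Finset.sum_congr rfl fun i _ => ?_
      rw [map_measureReal_apply hS (measurableSet_singleton i), smul_eq_mul, mul_comm]
    have hsum1 : ∀ (κ : Measure E) [IsProbabilityMeasure κ],
        ∑ i : I, κ.real (S ⁻¹' {i}) = 1 := fun κ _ => by
      simpa using hsumint κ fun _ => 1
    obtain ⟨w, hw0, hw1, hw2, hwB⟩ := exists_finite_coupling_of_dual_bound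
      (fun i j : I => d i j) (p := fun i => ρ.real (S ⁻¹' {i}))
      (q := fun i => ν.real (S ⁻¹' {i})) (fun _ => measureReal_nonneg)
      (fun _ => measureReal_nonneg) (hsum1 ρ) (hsum1 ν) (B := B + (a + b)) fun φ ψ hφψ => by
        obtain ⟨f, hf, ⟨c, hc⟩, hφ, hψ⟩ :=
          exists_bounded_lipschitz_of_dual hself hsymm htri (fun i : I => (i : E)) hφψ
        have hfm : Measurable f :=
          measurable_of_abs_sub_le (K := K) fun u v => (hf u v).trans (hK u v)
        have hfi : ∀ (κ : Measure E) [IsProbabilityMeasure κ], Integrable f κ := fun κ _ =>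
          Integrable.of_bound hfm.aestronglyMeasurable c (ae_of_all _ hc)
        have hfTi : ∀ (κ : Measure E) [IsProbabilityMeasure κ],
            Integrable (fun x => f (T N x)) κ := fun κ _ =>
          Integrable.of_bound (hfm.comp (T N).measurable).aestronglyMeasurable c
            (ae_of_all _ fun x => hc _)
        have h1 : ∑ i : I, φ i * ρ.real (S ⁻¹' {i}) ≤ ∫ x, f x ∂ρ + a := by
          calc _ ≤ ∑ i : I, f i * ρ.real (S ⁻¹' {i}) :=
                Finset.sum_le_sum fun i _ => mul_le_mul_of_nonneg_right (hφ i) measureReal_nonneg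
            _ = ∫ x, f (T N x) ∂ρ := hsumint ρ f
            _ ≤ ∫ x, (f x + d x (T N x)) ∂ρ :=
                integral_mono (hfTi ρ) ((hfi ρ).add (hint ρ hρ N)) fun x => by
                  have := (abs_le.1 (hf x (T N x))).1
                  simp only; linarith
            _ = _ := integral_add (hfi ρ) (hint ρ hρ N)
        have h2 : ∑ i : I, ψ i * ν.real (S ⁻¹' {i}) ≤ -∫ x, f x ∂ν + b := by
          calc _ ≤ ∑ i : I, -f i * ν.real (S ⁻¹' {i}) :=
                Finset.sum_le_sum fun i _ => mul_le_mul_of_nonneg_right (hψ i) measureReal_nonneg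
            _ = ∫ x, -f (T N x) ∂ν := hsumint ν fun x => -f x
            _ ≤ ∫ x, (d x (T N x) - f x) ∂ν :=
                integral_mono (hfTi ν).neg ((hint ν hν N).sub (hfi ν)) fun x => by
                  have := (abs_le.1 (hf x (T N x))).2
                  simp only; linarith
            _ = _ := by rw [integral_sub (hint ν hν N) (hfi ν)]; ring
        linarith [h f hf ⟨c, hc⟩]
    obtain ⟨π, hπ, hπc⟩ := exists_coupling_of_finite_coupling (ρ := ρ) (ν := ν) hSfib
      (w := fun i j => ENNReal.ofReal (w i j))
      (fun i => by
        rw [← ENNReal.ofReal_sum_of_nonneg fun j _ => hw0 i j, hw1, ofReal_measureReal])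
      (fun j => by
        rw [← ENNReal.ofReal_sum_of_nonneg fun i _ => hw0 i j, hw2, ofReal_measureReal])
    have hmid : ∫⁻ z, ENNReal.ofReal (d (T N z.1) (T N z.2)) ∂π ≤
        ENNReal.ofReal (B + (a + b)) := by
      refine (hπc fun i j => ENNReal.ofReal (d i j)).trans ?_
      simp only [← ENNReal.ofReal_mul (hnn _ _)]
      rw [Finset.sum_congr rfl fun i _ => (ENNReal.ofReal_sum_of_nonneg
        fun j _ => mul_nonneg (hnn _ _) (hw0 _ _)).symm, ← ENNReal.ofReal_sum_of_nonneg
        fun i _ => Finset.sum_nonneg fun j _ => mul_nonneg (hnn _ _) (hw0 _ _)]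
      exact ENNReal.ofReal_le_ofReal hwB
    have hm' : Measurable fun x => ENNReal.ofReal (d x (T N x)) := (hmeas N).ennreal_ofReal
    have hfst : ∫⁻ z, ENNReal.ofReal (d z.1 (T N z.1)) ∂π = ENNReal.ofReal a := by
      rw [← lintegral_map (f := fun x => ENNReal.ofReal (d x (T N x))) hm' measurable_fst, hπ.1,
        ofReal_integral_eq_lintegral_ofReal (hint ρ hρ N) (ae_of_all _ fun x => hnn _ _)]
    have hsnd : ∫⁻ z, ENNReal.ofReal (d z.2 (T N z.2)) ∂π = ENNReal.ofReal b := by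
      rw [← lintegral_map (f := fun x => ENNReal.ofReal (d x (T N x))) hm' measurable_snd, hπ.2,
        ofReal_integral_eq_lintegral_ofReal (hint ν hν N) (ae_of_all _ fun x => hnn _ _)]
    have ha : 0 ≤ a := integral_nonneg fun x => hnn _ _
    have hb : 0 ≤ b := integral_nonneg fun x => hnn _ _
    have hB : 0 ≤ B := by simpa using h (fun _ => 0) (by simpa using hnn) ⟨0, by simp⟩
    calc transportCost d ρ ν ≤ ∫⁻ z, ENNReal.ofReal (d z.1 z.2) ∂π := iInf₂_le π hπ
      _ ≤ ∫⁻ z, (ENNReal.ofReal (d (T N z.1) (T N z.2)) + ENNReal.ofReal (d z.1 (T N z.1)) +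
          ENNReal.ofReal (d z.2 (T N z.2))) ∂π := by
          refine lintegral_mono fun z => ?_
          rw [← ENNReal.ofReal_add (hnn _ _) (hnn _ _), ← ENNReal.ofReal_add
            (add_nonneg (hnn _ _) (hnn _ _)) (hnn _ _)]
          refine ENNReal.ofReal_le_ofReal ?_
          linarith [htri z.1 (T N z.1) z.2, htri (T N z.1) (T N z.2) z.2, hsymm (T N z.2) z.2]
      _ ≤ _ := by
          have hm1 : Measurable fun z : E × E => ENNReal.ofReal (d z.1 (T N z.1)) :=
            hm'.comp measurable_fst
          have hm2 : Measurable fun z : E × E => ENNReal.ofReal (d z.2 (T N z.2)) :=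
            hm'.comp measurable_snd
          rw [lintegral_add_right _ hm2, lintegral_add_right _ hm1, hfst, hsnd,
            ENNReal.ofReal_add (by linarith) (by linarith), ENNReal.ofReal_add ha hb,
            ← add_assoc]
          gcongr
  have ht := (((hlim ρ hρ).add (hlim ν hν)).const_add B).add ((hlim ρ hρ).add (hlim ν hν))
  simp only [add_zero] at ht
  exact ge_of_tendsto' (ENNReal.tendsto_ofReal ht) key

/-! ### Transportation inequalities and exponential moments -/

/-- A measure `ρ` is sub-Gaussian with constant `C` on Lipschitz functions for the cost `d`:
`∫ exp f ≤ exp (∫ f + C K² / 2)` for all bounded `K`-Lipschitz `f`. The usual parameter `λ` is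
absorbed into the Lipschitz constant `K`, and boundedness makes every integral meaningful. -/
def LipSubgaussian {E : Type*} [MeasurableSpace E] (d : E → E → ℝ) (C : ℝ) (ρ : Measure E) :
    Prop :=
  ∀ (K : ℝ) (f : E → ℝ), 0 ≤ K → (∀ u v, |f u - f v| ≤ K * d u v) → (∃ b, ∀ u, |f u| ≤ b) →
    ∫ x, Real.exp (f x) ∂ρ ≤ Real.exp (∫ x, f x ∂ρ + C * K ^ 2 / 2)

theorem LipSubgaussian.mono {E : Type*} [MeasurableSpace E] {d : E → E → ℝ} {C C' : ℝ}
    {ρ : Measure E} (h : LipSubgaussian d C ρ) (hC : C ≤ C') : LipSubgaussian d C' ρ :=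
  fun K f hK hf hb => (h K f hK hf hb).trans (by gcongr)

/-- The easy half of Kantorovich–Rubinstein duality. -/
theorem abs_integral_sub_integral_le_of_transportCost_le {E : Type*} [MeasurableSpace E]
    {d : E → E → ℝ} {ρ ν : Measure E} [IsProbabilityMeasure ρ] {B K : ℝ}
    (h : transportCost d ρ ν ≤ ENNReal.ofReal B) (hB : 0 ≤ B) (hK : 0 ≤ K) {f : E → ℝ}
    (hf : ∀ u v, |f u - f v| ≤ K * d u v) (hfm : Measurable f) (hfb : ∃ b, ∀ u, |f u| ≤ b) :
    |∫ x, f x ∂ρ - ∫ x, f x ∂ν| ≤ K * B := by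
  have key : ∀ ε : ℝ, 0 < ε → |∫ x, f x ∂ρ - ∫ x, f x ∂ν| ≤ K * (B + ε) := fun ε hε => by
    have h1 : transportCost d ρ ν < ENNReal.ofReal (B + ε) :=
      h.trans_lt ((ENNReal.ofReal_lt_ofReal_iff (by linarith)).2 (by linarith))
    obtain ⟨π, h1⟩ := iInf_lt_iff.1 h1
    obtain ⟨⟨hπ1, hπ2⟩, h1⟩ := iInf_lt_iff.1 h1
    have hp : IsProbabilityMeasure π := by
      refine ⟨?_⟩
      have := measure_univ (μ := ρ)
      rwa [← hπ1, Measure.map_apply measurable_fst MeasurableSet.univ] at this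
    have hi : ∀ g : E × E → E, Measurable g → Integrable (fun z => f (g z)) π := fun g hg =>
      integrable_of_abs_le (hfm.comp hg) (hfb.imp fun b hb z => hb _)
    have h2 : ∫ x, f x ∂ρ - ∫ x, f x ∂ν = ∫ z, (f z.1 - f z.2) ∂π := by
      rw [integral_sub (hi _ measurable_fst) (hi _ measurable_snd),
        ← hπ1, ← hπ2, integral_map measurable_fst.aemeasurable hfm.aestronglyMeasurable,
        integral_map measurable_snd.aemeasurable hfm.aestronglyMeasurable]
    have h3 := enorm_integral_le_lintegral_enorm (μ := π) fun z : E × E => f z.1 - f z.2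
    rw [← h2] at h3
    have h4 : ∫⁻ z : E × E, ‖f z.1 - f z.2‖ₑ ∂π ≤
        ENNReal.ofReal K * ENNReal.ofReal (B + ε) := by
      calc _ ≤ ∫⁻ z : E × E, ENNReal.ofReal K * ENNReal.ofReal (d z.1 z.2) ∂π := by
            refine lintegral_mono fun z => ?_
            simp only
            rw [← ENNReal.ofReal_mul hK, ← ofReal_norm, Real.norm_eq_abs]
            exact ENNReal.ofReal_le_ofReal (hf _ _)
        _ = ENNReal.ofReal K * ∫⁻ z : E × E, ENNReal.ofReal (d z.1 z.2) ∂π :=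
            lintegral_const_mul' _ _ ENNReal.ofReal_ne_top
        _ ≤ _ := by gcongr
    have h5 := h3.trans h4
    rwa [← ENNReal.ofReal_mul hK, ← ofReal_norm, Real.norm_eq_abs,
      ENNReal.ofReal_le_ofReal_iff (mul_nonneg hK (by linarith))] at h5
  refine le_of_forall_pos_le_add fun ε hε => (key (ε / (K + 1)) (by positivity)).trans ?_
  have : K * (ε / (K + 1)) ≤ ε := by
    rw [mul_div_assoc', div_le_iff₀ (by linarith)]
    nlinarith
  linarith

/-- `T₁(C)` implies the sub-Gaussian bound: the inequality is applied to the tilted measure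
`ν ∝ exp(f) ρ`, for which `H(ν | ρ) = ∫ f dν - log ∫ exp f dρ`. -/
theorem SatisfiesT1.lipSubgaussian {E : Type*} [MeasurableSpace E] {d : E → E → ℝ} {C : ℝ}
    {ρ : Measure E} [IsProbabilityMeasure ρ] (h : SatisfiesT1 d C ρ)
    (hd : ∀ (f : E → ℝ) (K : ℝ), (∀ u v, |f u - f v| ≤ K * d u v) → Measurable f) :
    LipSubgaussian d C ρ := by
  intro K f hK hf hb
  obtain ⟨hC, h⟩ := h
  have hfm := hd f K hf
  have hexp : Integrable (fun x => Real.exp (f x)) ρ :=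
    integrable_of_abs_le hfm.exp (exists_abs_exp_le hb)
  set ν := ρ.tilted f
  have hν : IsProbabilityMeasure ν := isProbabilityMeasure_tilted hexp
  have hac : ν ≪ ρ := tilted_absolutelyContinuous ρ f
  set Z := ∫ x, Real.exp (f x) ∂ρ
  have hZ : 0 < Z := integral_exp_pos hexp
  have hfν : Integrable f ν := integrable_of_abs_le hfm hb
  have hllr : llr ν ρ =ᵐ[ν] fun x => f x - Real.log Z :=
    hac.ae_le (log_rnDeriv_tilted_left_self hexp)
  have hint : Integrable (llr ν ρ) ν :=
    (hfν.sub (integrable_const _)).congr hllr.symm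
  have hkl : (klDiv ν ρ).toReal = ∫ x, f x ∂ν - Real.log Z := by
    rw [toReal_klDiv_of_measure_eq hac (by simp), integral_congr_ae hllr,
      integral_sub hfν (integrable_const _)]
    simp
  set H := (klDiv ν ρ).toReal
  have hH : 0 ≤ H := ENNReal.toReal_nonneg
  have h1 : transportCost d ρ ν ≤ ENNReal.ofReal (√(2 * C * H)) := by
    refine (h ν hν).trans_eq ?_
    rw [← ENNReal.ofReal_toReal (klDiv_ne_top hac hint), Real.sqrt_eq_rpow,
      ← ENNReal.ofReal_rpow_of_nonneg (by positivity) (by norm_num),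
      ENNReal.ofReal_mul (by positivity), ENNReal.ofReal_mul (by norm_num)]
    simp [H]
  have h2 := abs_integral_sub_integral_le_of_transportCost_le h1 (Real.sqrt_nonneg _) hK hf hfm hb
  have h3 := (abs_le.1 h2).1
  have hs : √(2 * C * H) ^ 2 = 2 * C * H := Real.sq_sqrt (by positivity)
  set s := √(2 * C * H)
  rw [← Real.exp_log hZ]
  refine Real.exp_le_exp.2 ?_
  have h4 : K * s - H ≤ C * K ^ 2 / 2 := by
    have : 0 ≤ (s - C * K) ^ 2 := sq_nonneg _
    have h5 : C * (K * s - H) ≤ C * (C * K ^ 2 / 2) := by nlinarith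
    exact le_of_mul_le_mul_left h5 hC
  linarith

/-- The Donsker–Varadhan inequality. -/
theorem integral_le_toReal_klDiv_add_log {E : Type*} [MeasurableSpace E] {ρ ν : Measure E}
    [IsProbabilityMeasure ρ] [IsProbabilityMeasure ν] (h : klDiv ν ρ ≠ ∞) {f : E → ℝ}
    (hf : Measurable f) (hb : ∃ b, ∀ u, |f u| ≤ b) :
    ∫ x, f x ∂ν ≤ (klDiv ν ρ).toReal + Real.log (∫ x, Real.exp (f x) ∂ρ) := by
  obtain ⟨hac, hint⟩ := klDiv_ne_top_iff.1 h
  have hexp : Integrable (fun x => Real.exp (f x)) ρ :=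
    integrable_of_abs_le hf.exp (exists_abs_exp_le hb)
  have hfν : Integrable f ν := integrable_of_abs_le hf hb
  have : IsProbabilityMeasure (ρ.tilted f) := isProbabilityMeasure_tilted hexp
  have h1 := integral_llr_tilted_right hac hfν hexp hint
  have h2 : 0 ≤ ∫ x, llr ν (ρ.tilted f) x ∂ν := by
    rw [← toReal_klDiv_of_measure_eq (hac.trans (absolutelyContinuous_tilted hexp)) (by simp)]
    exact ENNReal.toReal_nonneg
  rw [toReal_klDiv_of_measure_eq hac (by simp)]
  linarith

theorem integrable_of_forall_integral_min_le {E : Type*} [MeasurableSpace E] {ρ : Measure E}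
    [IsFiniteMeasure ρ] {g : E → ℝ} (hg : Measurable g) (hg0 : ∀ x, 0 ≤ g x) {R : ℝ}
    (h : ∀ m : ℕ, ∫ x, min (g x) m ∂ρ ≤ R) : Integrable g ρ := by
  refine ⟨hg.aestronglyMeasurable, ?_⟩
  rw [hasFiniteIntegral_iff_ofReal (ae_of_all _ hg0)]
  have h1 : ∀ x, ENNReal.ofReal (g x) = ⨆ m : ℕ, ENNReal.ofReal (min (g x) m) := fun x => by
    refine le_antisymm ?_ (iSup_le fun m => ENNReal.ofReal_le_ofReal (min_le_left _ _))
    refine le_iSup_of_le ⌈g x⌉₊ (ENNReal.ofReal_le_ofReal (le_min le_rfl (Nat.le_ceil _)))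
  simp_rw [h1]
  rw [lintegral_iSup (fun m => (hg.min measurable_const).ennreal_ofReal)
    (fun m n hmn x => ENNReal.ofReal_le_ofReal (min_le_min_left _ (Nat.cast_le.2 hmn)))]
  refine (iSup_le fun m => ?_).trans_lt (ENNReal.ofReal_lt_top (r := R))
  rw [← ofReal_integral_eq_lintegral_ofReal
    (integrable_of_abs_le (hg.min measurable_const) ⟨m, fun x => ?_⟩)
    (ae_of_all _ fun x => le_min (hg0 x) (Nat.cast_nonneg m))]
  · exact ENNReal.ofReal_le_ofReal (h m)
  · rw [abs_of_nonneg (le_min (hg0 x) (Nat.cast_nonneg m))]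
    exact min_le_right _ _

/-- The sub-Gaussian bound implies `T₁(C)`. First moments, needed for duality, are not assumed: the
sub-Gaussian bound for `-min (dist x₀ ·) m`, uniform in `m`, gives them for `ρ`, and finite relative
entropy transfers them to `ν`. -/
theorem LipSubgaussian.satisfiesT1 {E : Type*} [MetricSpace E]
    [TopologicalSpace.SeparableSpace E] [MeasurableSpace E] [BorelSpace E]
    {d : E → E → ℝ} (hself : ∀ x, d x x = 0) (hsymm : ∀ x y, d x y = d y x)
    (htri : ∀ x y z, d x z ≤ d x y + d y z) (hcont : Continuous fun z : E × E => d z.1 z.2)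
    {K : ℝ} (hK : ∀ x y, d x y ≤ K * dist x y) (hdist : ∀ x y, dist x y ≤ d x y)
    {ρ : Measure E} [IsProbabilityMeasure ρ] {C : ℝ} (hC : 0 < C) (h : LipSubgaussian d C ρ) :
    SatisfiesT1 d C ρ := by
  refine ⟨hC, fun ν hν => ?_⟩
  by_cases hkl : klDiv ν ρ = ∞
  · rw [hkl, ENNReal.mul_top (by simp [hC]), ENNReal.top_rpow_of_pos (by norm_num)]
    exact le_top
  set H := (klDiv ν ρ).toReal
  have hH : 0 ≤ H := ENNReal.toReal_nonneg
  have hmeas : ∀ f : E → ℝ, (∀ u v, |f u - f v| ≤ d u v) → Measurable f := fun f hf =>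
    measurable_of_abs_sub_le (K := K) fun u v => (hf u v).trans (hK u v)
  have hdiff : ∀ f : E → ℝ, (∀ u v, |f u - f v| ≤ d u v) → (∃ b, ∀ u, |f u| ≤ b) →
      ∫ x, f x ∂ρ - ∫ x, f x ∂ν ≤ √(2 * C * H) := fun f hf hb => by
    set x := ∫ x, f x ∂ρ - ∫ x, f x ∂ν
    rcases le_or_gt x 0 with hx | hx
    · exact hx.trans (Real.sqrt_nonneg _)
    have hb' : ∃ b, ∀ u, |-(x / C) * f u| ≤ b := by
      obtain ⟨b, hb⟩ := hb
      refine ⟨|x / C| * b, fun u => ?_⟩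
      rw [abs_mul, abs_neg]
      exact mul_le_mul_of_nonneg_left (hb u) (abs_nonneg _)
    -- The multiple `-(x / C) f` is the optimal one in the Donsker–Varadhan inequality.
    have h1 := integral_le_toReal_klDiv_add_log hkl ((hmeas f hf).const_mul (-(x / C))) hb'
    have h2 := h (x / C) (fun u => -(x / C) * f u) (by positivity) (fun u v => by
      rw [← mul_sub, abs_mul, abs_neg, abs_of_pos (show 0 < x / C by positivity)]
      exact mul_le_mul_of_nonneg_left (hf u v) (by positivity)) hb'
    have hpos : 0 < ∫ u, Real.exp (-(x / C) * f u) ∂ρ :=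
      integral_exp_pos (integrable_of_abs_le ((hmeas f hf).const_mul _).exp (exists_abs_exp_le hb'))
    have h3 := Real.log_le_log hpos h2
    rw [Real.log_exp] at h3
    simp only [integral_const_mul] at h1 h3
    refine Real.le_sqrt_of_sq_le ?_
    have h4 : x / C * x ≤ H + C * (x / C) ^ 2 / 2 := by
      have : x / C * x = -(x / C) * ∫ x, f x ∂ν - -(x / C) * ∫ x, f x ∂ρ := by
        simp only [x]; ring
      linarith
    have h5 : C * (x / C) ^ 2 / 2 = x ^ 2 / C / 2 := by field_simp
    have h6 : x / C * x = x ^ 2 / C := by ring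
    rw [h5, h6] at h4
    have h7 : x ^ 2 / C ≤ 2 * H := by linarith
    rw [div_le_iff₀ hC] at h7
    linarith
  have htrunc : ∀ (x₀ : E) (m : ℕ),
      (∀ u v, |-min (dist x₀ u) (m : ℝ) - -min (dist x₀ v) (m : ℝ)| ≤ d u v) ∧
      ∃ b, ∀ u, |-min (dist x₀ u) (m : ℝ)| ≤ b := fun x₀ m => by
    refine ⟨fun u v => ?_, m, fun u => ?_⟩
    · refine le_trans ?_ (hdist u v)
      have h1 := dist_triangle x₀ u v
      have h2 := dist_triangle x₀ v u
      rw [dist_comm v u] at h2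
      rw [abs_le]
      constructor <;> rcases min_cases (dist x₀ u) (m : ℝ) with h | h <;>
        rcases min_cases (dist x₀ v) (m : ℝ) with h' | h' <;> linarith
    · rw [abs_neg, abs_of_nonneg (le_min dist_nonneg (Nat.cast_nonneg m))]
      exact min_le_right _ _
  have hdm : ∀ x₀ : E, Measurable fun x => dist x₀ x := fun x₀ =>
    (continuous_const.dist continuous_id).measurable
  have hρ : ∀ x₀, Integrable (fun x => dist x₀ x) ρ := fun x₀ => by
    have hexp : Integrable (fun x => Real.exp (-dist x₀ x)) ρ :=
      integrable_of_abs_le (hdm x₀).neg.exp ⟨1, fun x => by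
        rw [abs_of_pos (Real.exp_pos _)]
        exact Real.exp_le_one_iff.2 (neg_nonpos.2 dist_nonneg)⟩
    refine integrable_of_forall_integral_min_le (hdm x₀) (fun x => dist_nonneg)
      (R := C / 2 - Real.log (∫ x, Real.exp (-dist x₀ x) ∂ρ)) fun m => ?_
    obtain ⟨h1, h2⟩ := htrunc x₀ m
    have h3 := h 1 _ zero_le_one (by simpa using h1) h2
    have h4 : ∫ x, Real.exp (-dist x₀ x) ∂ρ ≤ ∫ x, Real.exp (-min (dist x₀ x) (m : ℝ)) ∂ρ :=
      integral_mono hexp (integrable_of_abs_le ((hdm x₀).min measurable_const).neg.exp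
        (exists_abs_exp_le h2)) fun x =>
          Real.exp_le_exp.2 (neg_le_neg (min_le_left _ _))
    have h5 := Real.log_le_log (integral_exp_pos hexp) (h4.trans h3)
    rw [Real.log_exp, integral_neg] at h5
    linarith
  have hν' : ∀ x₀, Integrable (fun x => dist x₀ x) ν := fun x₀ => by
    refine integrable_of_forall_integral_min_le (hdm x₀) (fun x => dist_nonneg)
      (R := ∫ x, dist x₀ x ∂ρ + √(2 * C * H)) fun m => ?_
    obtain ⟨h1, h2⟩ := htrunc x₀ m
    have h3 := hdiff _ h1 h2
    rw [integral_neg, integral_neg] at h3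
    have h4 : ∫ x, min (dist x₀ x) (m : ℝ) ∂ρ ≤ ∫ x, dist x₀ x ∂ρ :=
      integral_mono (integrable_of_abs_le ((hdm x₀).min measurable_const) (by simpa using h2))
        (hρ x₀) fun x => min_le_left _ _
    linarith
  refine (transportCost_le_of_forall_bounded_lipschitz hself hsymm htri hcont hK hρ hν'
    hdiff).trans_eq ?_
  rw [← ENNReal.ofReal_toReal hkl, Real.sqrt_eq_rpow,
    ← ENNReal.ofReal_rpow_of_nonneg (by positivity) (by norm_num),
    ENNReal.ofReal_mul (by positivity), ENNReal.ofReal_mul (by norm_num)]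
  simp [H]

/-! ### Product measures -/

section l1

variable {E : Type*} [MetricSpace E] {n : ℕ}

theorem l1Dist_self (u : Fin n → E) : l1Dist u u = 0 := by simp [l1Dist]

theorem l1Dist_comm (u v : Fin n → E) : l1Dist u v = l1Dist v u := by
  simp [l1Dist, dist_comm]

theorem l1Dist_triangle (u v w : Fin n → E) : l1Dist u w ≤ l1Dist u v + l1Dist v w := by
  simp only [l1Dist, ← Finset.sum_add_distrib]
  exact Finset.sum_le_sum fun i _ => dist_triangle _ _ _

theorem continuous_l1Dist : Continuous fun z : (Fin n → E) × (Fin n → E) => l1Dist z.1 z.2 := by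
  unfold l1Dist
  fun_prop

theorem l1Dist_le_mul_dist (u v : Fin n → E) : l1Dist u v ≤ n * dist u v := by
  calc l1Dist u v ≤ ∑ _i : Fin n, dist u v := Finset.sum_le_sum fun i _ => dist_le_pi_dist u v i
    _ = _ := by simp

theorem dist_le_l1Dist (u v : Fin n → E) : dist u v ≤ l1Dist u v :=
  (dist_pi_le_iff (Finset.sum_nonneg fun _ _ => dist_nonneg)).2 fun i =>
    Finset.single_le_sum (f := fun i => dist (u i) (v i)) (fun _ _ => dist_nonneg)
      (Finset.mem_univ i)

theorem l1Dist_cons (y y' : E) (u v : Fin n → E) :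
    l1Dist (Fin.cons y u : Fin (n + 1) → E) (Fin.cons y' v) = dist y y' + l1Dist u v := by
  simp [l1Dist, Fin.sum_univ_succ]

theorem measurable_of_abs_sub_le_l1Dist [TopologicalSpace.SeparableSpace E] [MeasurableSpace E]
    [BorelSpace E] {f : (Fin n → E) → ℝ} {K : ℝ} (hK : 0 ≤ K)
    (hf : ∀ u v, |f u - f v| ≤ K * l1Dist u v) : Measurable f := by
  have : SecondCountableTopology E := UniformSpace.secondCountable_of_separable E
  refine measurable_of_abs_sub_le (K := K * n) fun u v => (hf u v).trans ?_
  rw [mul_assoc]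
  exact mul_le_mul_of_nonneg_left (l1Dist_le_mul_dist u v) hK

end l1

section tensor

/-- Fubini's theorem for a product measure, splitting off the first coordinate. -/
theorem integral_pi_succ {E : Type*} [MeasurableSpace E] {n : ℕ} (κ : Fin (n + 1) → Measure E)
    [∀ i, IsProbabilityMeasure (κ i)] {f : (Fin (n + 1) → E) → ℝ} (hf : Measurable f)
    (hb : ∃ b, ∀ u, |f u| ≤ b) :
    ∫ u, f u ∂Measure.pi κ =
      ∫ y, ∫ u, f (Fin.cons y u) ∂Measure.pi (fun i : Fin n => κ i.succ) ∂κ 0 := by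
  have h1 := (measurePreserving_piFinSuccAbove κ 0).symm
  have h2 := h1.integral_comp' (g := f)
  have h3 : ∀ z : E × (Fin n → E), (MeasurableEquiv.piFinSuccAbove (fun _ => E) 0).symm z =
      Fin.cons z.1 z.2 := fun z => by
    simp [MeasurableEquiv.piFinSuccAbove, Fin.insertNthEquiv]
  have hm : Measurable fun z : E × (Fin n → E) => f (Fin.cons z.1 z.2) := by
    have := hf.comp (MeasurableEquiv.piFinSuccAbove (fun _ => E) 0).symm.measurable
    simpa only [Function.comp_def, h3] using this
  rw [← h2]
  simp only [h3, Fin.zero_succAbove]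
  rw [integral_prod _ (integrable_of_abs_le hm (hb.imp fun b hb z => hb _))]

variable {E : Type*} [MetricSpace E]

theorem abs_cons_sub_cons_le_tail {n : ℕ} {f : (Fin (n + 1) → E) → ℝ} {K : ℝ}
    (hf : ∀ u v, |f u - f v| ≤ K * l1Dist u v) (y : E) (u v : Fin n → E) :
    |f (Fin.cons y u) - f (Fin.cons y v)| ≤ K * l1Dist u v := by
  simpa [l1Dist_cons] using hf (Fin.cons y u) (Fin.cons y v)

theorem abs_cons_sub_cons_le_head {n : ℕ} {f : (Fin (n + 1) → E) → ℝ} {K : ℝ}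
    (hf : ∀ u v, |f u - f v| ≤ K * l1Dist u v) (y y' : E) (u : Fin n → E) :
    |f (Fin.cons y u) - f (Fin.cons y' u)| ≤ K * dist y y' := by
  simpa [l1Dist_cons, l1Dist_self] using hf (Fin.cons y u) (Fin.cons y' u)

variable [TopologicalSpace.SeparableSpace E] [MeasurableSpace E] [BorelSpace E]

theorem integrable_cons {n : ℕ} {f : (Fin (n + 1) → E) → ℝ} {K : ℝ} (hK : 0 ≤ K)
    (hf : ∀ u v, |f u - f v| ≤ K * l1Dist u v) (hb : ∃ b, ∀ u, |f u| ≤ b)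
    (κ : Measure (Fin n → E)) [IsFiniteMeasure κ] (y : E) :
    Integrable (fun u => f (Fin.cons y u)) κ :=
  integrable_of_abs_le (measurable_of_abs_sub_le_l1Dist hK (abs_cons_sub_cons_le_tail hf y))
    (hb.imp fun _ hb _ => hb _)

theorem abs_integral_cons_sub_le {n : ℕ} {f : (Fin (n + 1) → E) → ℝ} {K : ℝ} (hK : 0 ≤ K)
    (hf : ∀ u v, |f u - f v| ≤ K * l1Dist u v) (hb : ∃ b, ∀ u, |f u| ≤ b)
    (κ : Measure (Fin n → E)) [IsProbabilityMeasure κ] (y y' : E) :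
    |∫ u, f (Fin.cons y u) ∂κ - ∫ u, f (Fin.cons y' u) ∂κ| ≤ K * dist y y' :=
  abs_integral_sub_integral_le (integrable_cons hK hf hb κ y) (integrable_cons hK hf hb κ y')
    (abs_cons_sub_cons_le_head hf y y')

/-- Tensorization: `n` independent coordinates multiply the sub-Gaussian constant by `n` for the
`ℓ¹`-metric. -/
theorem LipSubgaussian.pi {C : ℝ} {n : ℕ} (κ : Fin n → Measure E)
    [∀ i, IsProbabilityMeasure (κ i)]
    (h : ∀ i, LipSubgaussian (fun y y' : E => dist y y') C (κ i)) :
    LipSubgaussian l1Dist (n * C) (Measure.pi κ) := by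
  induction n with
  | zero =>
    intro K f hK hf hb
    have h1 : ∀ u, f u = f default := fun u => by rw [Subsingleton.elim u default]
    simp [h1]
  | succ n ih =>
    intro K f hK hf hb
    have hfm := measurable_of_abs_sub_le_l1Dist hK hf
    set τ := Measure.pi fun i : Fin n => κ i.succ
    have hGlip := abs_integral_cons_sub_le hK hf hb τ
    have hGb : ∃ b, ∀ y, |∫ u, f (Fin.cons y u) ∂τ| ≤ b :=
      hb.imp fun b hb y => abs_integral_le fun u => hb _
    have hGm := measurable_of_abs_sub_le hGlip
    have hG := h 0 K _ hK hGlip hGb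
    have htail : ∀ y, ∫ u, Real.exp (f (Fin.cons y u)) ∂τ ≤
        Real.exp (n * C * K ^ 2 / 2) * Real.exp (∫ u, f (Fin.cons y u) ∂τ) := fun y => by
      rw [← Real.exp_add, add_comm (n * C * K ^ 2 / 2)]
      exact ih (fun i => κ i.succ) (fun i => h i.succ) K _ hK (abs_cons_sub_cons_le_tail hf y)
        (hb.imp fun _ hb u => hb _)
    rw [integral_pi_succ κ hfm.exp (exists_abs_exp_le hb), integral_pi_succ κ hfm hb]
    calc ∫ y, ∫ u, Real.exp (f (Fin.cons y u)) ∂τ ∂κ 0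
        ≤ ∫ y, Real.exp (n * C * K ^ 2 / 2) * Real.exp (∫ u, f (Fin.cons y u) ∂τ) ∂κ 0 :=
          integral_mono_of_nonneg
            (ae_of_all _ fun y => integral_nonneg fun u => (Real.exp_pos _).le)
            ((integrable_of_abs_le hGm.exp (exists_abs_exp_le hGb)).const_mul _)
            (ae_of_all _ htail)
      _ = Real.exp (n * C * K ^ 2 / 2) * ∫ y, Real.exp (∫ u, f (Fin.cons y u) ∂τ) ∂κ 0 :=
          integral_const_mul _ _
      _ ≤ Real.exp (n * C * K ^ 2 / 2) *
          Real.exp (∫ y, ∫ u, f (Fin.cons y u) ∂τ ∂κ 0 + C * K ^ 2 / 2) := by gcongr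
      _ = _ := by
          rw [← Real.exp_add]
          congr 1
          push_cast
          ring

/-- The means of an `ℓ¹`-Lipschitz function under two product measures differ by at most the sum of
the discrepancies of their factors. -/
theorem abs_integral_pi_sub_integral_pi_le {n : ℕ} {K : ℝ} (hK : 0 ≤ K) (κ κ' : Fin n → Measure E)
    [∀ i, IsProbabilityMeasure (κ i)] [∀ i, IsProbabilityMeasure (κ' i)] (δ : Fin n → ℝ)
    (h : ∀ i (f : E → ℝ), (∀ u v, |f u - f v| ≤ K * dist u v) → (∃ b, ∀ u, |f u| ≤ b) →
      |∫ y, f y ∂κ i - ∫ y, f y ∂κ' i| ≤ δ i)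
    {f : (Fin n → E) → ℝ} (hf : ∀ u v, |f u - f v| ≤ K * l1Dist u v) (hb : ∃ b, ∀ u, |f u| ≤ b) :
    |∫ u, f u ∂Measure.pi κ - ∫ u, f u ∂Measure.pi κ'| ≤ ∑ i, δ i := by
  induction n with
  | zero =>
    have h1 : ∀ u, f u = f default := fun u => by rw [Subsingleton.elim u default]
    simp [h1]
  | succ n ih =>
    have hfm := measurable_of_abs_sub_le_l1Dist hK hf
    rw [integral_pi_succ κ hfm hb, integral_pi_succ κ' hfm hb, Fin.sum_univ_succ]
    set τ := Measure.pi fun i : Fin n => κ i.succ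
    set τ' := Measure.pi fun i : Fin n => κ' i.succ
    have hlip := abs_integral_cons_sub_le hK hf hb τ
    have hlip' := abs_integral_cons_sub_le hK hf hb τ'
    have hb1 : ∃ b, ∀ y, |∫ u, f (Fin.cons y u) ∂τ| ≤ b :=
      hb.imp fun b hb y => abs_integral_le fun u => hb _
    have hb2 : ∃ b, ∀ y, |∫ u, f (Fin.cons y u) ∂τ'| ≤ b :=
      hb.imp fun b hb y => abs_integral_le fun u => hb _
    have h1 : |∫ y, ∫ u, f (Fin.cons y u) ∂τ ∂κ 0 - ∫ y, ∫ u, f (Fin.cons y u) ∂τ' ∂κ 0| ≤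
        ∑ i : Fin n, δ i.succ :=
      abs_integral_sub_integral_le (integrable_of_abs_le (measurable_of_abs_sub_le hlip) hb1)
        (integrable_of_abs_le (measurable_of_abs_sub_le hlip') hb2) fun y =>
          ih (fun i => κ i.succ) (fun i => κ' i.succ) (fun i => δ i.succ) (fun i => h i.succ)
            (abs_cons_sub_cons_le_tail hf y) (hb.imp fun _ hb u => hb _)
    have h2 := h 0 _ hlip' hb2
    exact (abs_sub_le _ _ _).trans ((add_le_add h1 h2).trans_eq (add_comm _ _))

end tensor

/-! ### Hoeffding's lemma -/

/-- Hoeffding's lemma, for a function of oscillation at most `c`. -/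
theorem integral_exp_le_of_forall_abs_sub_le {E : Type*} [MeasurableSpace E] {ρ : Measure E}
    [IsProbabilityMeasure ρ] {h : E → ℝ} (hm : Measurable h) {c : ℝ} (hc : 0 ≤ c)
    (hosc : ∀ x y, |h x - h y| ≤ c) :
    ∫ x, Real.exp (h x) ∂ρ ≤ Real.exp (∫ x, h x ∂ρ + c ^ 2 / 8) := by
  have : Nonempty E := ρ.nonempty_of_neZero
  have hbdd : BddBelow (Set.range h) := by
    obtain ⟨x₀⟩ := this
    refine ⟨h x₀ - c, ?_⟩
    rintro _ ⟨x, rfl⟩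
    linarith [(abs_le.1 (hosc x x₀)).1]
  have hI : ∀ x, h x ∈ Set.Icc (⨅ y, h y) ((⨅ y, h y) + c) := fun x => by
    refine ⟨ciInf_le hbdd x, ?_⟩
    have : h x - c ≤ ⨅ y, h y := le_ciInf fun y => by linarith [(abs_le.1 (hosc x y)).2]
    linarith
  have h1 := (ProbabilityTheory.hasSubgaussianMGF_of_mem_Icc (μ := ρ) hm.aemeasurable
    (ae_of_all _ hI)).mgf_le 1
  simp only [ProbabilityTheory.mgf, one_mul, Real.exp_sub, integral_div, one_pow, mul_one,
    add_sub_cancel_left] at h1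
  rw [div_le_iff₀ (Real.exp_pos _), ← Real.exp_add] at h1
  refine h1.trans_eq ?_
  congr 1
  push_cast
  rw [Real.norm_of_nonneg hc]
  ring

/-- Hoeffding's lemma for a probability vector on a finite type. -/
theorem sum_mul_exp_le {α : Type*} [Fintype α] {p h : α → ℝ} (hp : ∀ a, 0 ≤ p a)
    (hp1 : ∑ a, p a = 1) {c : ℝ} (hc : 0 ≤ c) (hosc : ∀ a b, |h a - h b| ≤ c) :
    ∑ a, p a * Real.exp (h a) ≤ Real.exp (∑ a, p a * h a + c ^ 2 / 8) := by
  let _ : MeasurableSpace α := ⊤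
  let ρ : Measure α := ∑ a, ENNReal.ofReal (p a) • Measure.dirac a
  have hρ : IsProbabilityMeasure ρ := ⟨by
    simp [ρ, Measure.finsetSum_apply, ← ENNReal.ofReal_sum_of_nonneg fun a _ => hp a, hp1]⟩
  have hint : ∀ g : α → ℝ, ∫ a, g a ∂ρ = ∑ a, p a * g a := fun g => by
    rw [integral_finsetSum_measure fun a _ => Integrable.of_finite.smul_measure
      ENNReal.ofReal_ne_top]
    simp [integral_smul_measure, hp]
  have h1 := integral_exp_le_of_forall_abs_sub_le (ρ := ρ) (Measurable.of_discrete (f := h)) hc hosc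
  rwa [hint, hint] at h1

theorem lipSubgaussian_of_dist_le_one {𝓨 : Type*} [MetricSpace 𝓨] [MeasurableSpace 𝓨]
    [BorelSpace 𝓨] (hd : ∀ y y' : 𝓨, dist y y' ≤ 1) (κ : Measure 𝓨)
    [IsProbabilityMeasure κ] : LipSubgaussian (fun y y' : 𝓨 => dist y y') (1 / 4) κ := by
  intro K f hK hf _
  refine (integral_exp_le_of_forall_abs_sub_le (measurable_of_abs_sub_le hf) hK fun x y =>
    (hf x y).trans (mul_le_of_le_one_right hK (hd x y))).trans_eq ?_
  congr 2
  ring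

/-! ### Functions of a Markov path -/

/-- The expectation of `F (X₁, …, Xₙ)` for the Markov chain with transition matrix `Q` started at
`X₀ = a`; the starting point is not part of the path. -/
def pathMean {α : Type*} [Fintype α] (Q : Matrix α α ℝ) :
    (n : ℕ) → α → ((Fin n → α) → ℝ) → ℝ
  | 0, _, F => F Fin.elim0
  | n + 1, a, F => ∑ b, Q a b * pathMean Q n b fun x => F (Fin.cons b x)

section path

variable {α : Type*} [Fintype α] {Q : Matrix α α ℝ}

/-- Summation of the path weights, with weight `c` for the first state of the path. -/
theorem sum_prod_mul_eq_sum_pathMean (Q : Matrix α α ℝ) (n : ℕ) (c : α → ℝ)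
    (F : (Fin (n + 1) → α) → ℝ) :
    ∑ x : Fin (n + 1) → α, c (x 0) * (∏ k : Fin n, Q (x k.castSucc) (x k.succ)) * F x =
      ∑ a, c a * pathMean Q n a fun x => F (Fin.cons a x) := by
  induction n generalizing c with
  | zero =>
    rw [← (Fin.consEquiv fun _ => α).sum_comp, Fintype.sum_prod_type]
    simp [pathMean, Fin.consEquiv, Subsingleton.elim default (Fin.elim0 : Fin 0 → α)]
  | succ n ih =>
    rw [← (Fin.consEquiv fun _ => α).sum_comp, Fintype.sum_prod_type]
    refine Finset.sum_congr rfl fun a _ => ?_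
    have h1 := ih (Q a) fun x => F (Fin.cons a x)
    rw [pathMean, ← h1, Finset.mul_sum]
    refine Finset.sum_congr rfl fun x _ => ?_
    simp only [Fin.consEquiv, Equiv.coe_fn_mk, Fin.cons_zero, Fin.prod_univ_succ,
      Fin.castSucc_zero, Fin.cons_succ, ← Fin.succ_castSucc]
    ring

theorem pathMean_sub (n : ℕ) (a : α) (F G : (Fin n → α) → ℝ) :
    pathMean Q n a (fun x => F x - G x) = pathMean Q n a F - pathMean Q n a G := by
  induction n generalizing a with
  | zero => rfl
  | succ n ih => simp only [pathMean, ih, mul_sub, Finset.sum_sub_distrib]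

theorem pathMean_const (hQ1 : ∀ a, ∑ b, Q a b = 1) (n : ℕ) (a : α) (c : ℝ) :
    pathMean Q n a (fun _ => c) = c := by
  induction n generalizing a with
  | zero => rfl
  | succ n ih => simp only [pathMean, ih, ← Finset.sum_mul, hQ1, one_mul]

theorem pathMean_mono (hQ : ∀ a b, 0 ≤ Q a b) (n : ℕ) (a : α) {F G : (Fin n → α) → ℝ}
    (h : ∀ x, F x ≤ G x) : pathMean Q n a F ≤ pathMean Q n a G := by
  induction n generalizing a with
  | zero => exact h _
  | succ n ih =>
    exact Finset.sum_le_sum fun b _ => mul_le_mul_of_nonneg_left (ih b fun x => h _) (hQ a b)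

theorem abs_pathMean_le (hQ : ∀ a b, 0 ≤ Q a b) (hQ1 : ∀ a, ∑ b, Q a b = 1) (n : ℕ) (a : α)
    {F : (Fin n → α) → ℝ} {c : ℝ} (h : ∀ x, |F x| ≤ c) : |pathMean Q n a F| ≤ c := by
  rw [abs_le]
  constructor
  · rw [← pathMean_const hQ1 n a (-c)]
    exact pathMean_mono hQ n a fun x => (abs_le.1 (h x)).1
  · rw [← pathMean_const hQ1 n a c]
    exact pathMean_mono hQ n a fun x => (abs_le.1 (h x)).2

variable [DecidableEq α]

/-- The mean of a Hamming-Lipschitz function of the path, integrated against a signed starting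
measure `v` of mass zero. Replacing the first state of the path by a fixed state `z` costs `K` times
the total mass of `v Q`, and the rest is a function of a shorter path started from `v Q`. -/
theorem abs_sum_mul_pathMean_le (hQ : ∀ a b, 0 ≤ Q a b) (hQ1 : ∀ a, ∑ b, Q a b = 1) {K : ℝ}
    (n : ℕ) {F : (Fin n → α) → ℝ} (hF : ∀ x y, |F x - F y| ≤ ∑ i, if x i ≠ y i then K else 0)
    (hK : 0 ≤ K) {v : α → ℝ} (hv : ∑ a, v a = 0) :
    |∑ a, v a * pathMean Q n a F| ≤
      K * ∑ s ∈ Finset.range n, ∑ b, |(Matrix.vecMul v (Q ^ (s + 1))) b| := by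
  induction n generalizing v with
  | zero => simp [pathMean, ← Finset.sum_mul, hv]
  | succ n ih =>
    rcases isEmpty_or_nonempty α with hα | ⟨⟨z⟩⟩
    · simp
    set u := Matrix.vecMul v Q
    have hu : ∑ b, u b = 0 := by
      simp only [u, Matrix.vecMul, dotProduct]
      rw [Finset.sum_comm]
      simp only [← Finset.mul_sum, hQ1, mul_one, hv]
    have h1 : ∑ a, v a * pathMean Q (n + 1) a F =
        ∑ b, u b * pathMean Q n b (fun x => F (Fin.cons b x) - F (Fin.cons z x)) +
          ∑ b, u b * pathMean Q n b (fun x => F (Fin.cons z x)) := by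
      simp only [pathMean_sub, ← Finset.sum_add_distrib, ← mul_add, sub_add_cancel]
      simp only [pathMean, u, Matrix.vecMul, dotProduct, Finset.mul_sum, Finset.sum_mul]
      rw [Finset.sum_comm]
      simp only [mul_assoc]
    have h2 : |∑ b, u b * pathMean Q n b (fun x => F (Fin.cons b x) - F (Fin.cons z x))| ≤
        K * ∑ b, |u b| := by
      rw [Finset.mul_sum]
      refine (Finset.abs_sum_le_sum_abs _ _).trans (Finset.sum_le_sum fun b _ => ?_)
      rw [abs_mul, mul_comm]
      refine mul_le_mul_of_nonneg_right (abs_pathMean_le hQ hQ1 n b fun x => ?_) (abs_nonneg _)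
      refine (hF _ _).trans ?_
      simp only [Fin.sum_univ_succ, Fin.cons_zero, Fin.cons_succ]
      simp only [ne_eq, not_true_eq_false, if_false, Finset.sum_const_zero, add_zero]
      split_ifs <;> linarith
    have h3 := ih (F := fun x => F (Fin.cons z x)) (fun x y => by
      simpa [Fin.sum_univ_succ] using hF (Fin.cons z x) (Fin.cons z y)) hu
    rw [h1, Finset.sum_range_succ', mul_add, add_comm (K * _)]
    refine (abs_add_le _ _).trans (add_le_add ?_ ?_)
    · simpa [u] using h2
    · simpa only [u, Matrix.vecMul_vecMul, ← pow_succ'] using h3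

/-- The mean of a Hamming-Lipschitz function of the path, as a function of its first state, has
oscillation at most `K (1 + Δ)`: a jump `K` for the first coordinate, the rest for the later
ones. -/
theorem abs_pathMean_cons_sub_le (hQ : ∀ a b, 0 ≤ Q a b) (hQ1 : ∀ a, ∑ b, Q a b = 1) {K Δ : ℝ}
    (hK : 0 ≤ K) (hΔ : ∀ (m : ℕ) (a a' : α),
      ∑ s ∈ Finset.range m, ∑ b, |(Q ^ (s + 1)) a b - (Q ^ (s + 1)) a' b| ≤ Δ) (n : ℕ)
    {F : (Fin (n + 1) → α) → ℝ} (hF : ∀ x y, |F x - F y| ≤ ∑ i, if x i ≠ y i then K else 0)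
    (a a' : α) :
    |pathMean Q n a (fun x => F (Fin.cons a x)) - pathMean Q n a' (fun x => F (Fin.cons a' x))| ≤
      K * (1 + Δ) := by
  have h1 : |pathMean Q n a (fun x => F (Fin.cons a x) - F (Fin.cons a' x))| ≤ K := by
    refine abs_pathMean_le hQ hQ1 n a fun x => (hF _ _).trans ?_
    simp only [Fin.sum_univ_succ, Fin.cons_zero, Fin.cons_succ]
    simp only [ne_eq, not_true_eq_false, if_false, Finset.sum_const_zero, add_zero]
    split_ifs <;> linarith
  have h2 := abs_sum_mul_pathMean_le hQ hQ1 n (F := fun x => F (Fin.cons a' x)) (fun x y => by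
    simpa [Fin.sum_univ_succ] using hF (Fin.cons a' x) (Fin.cons a' y)) hK
    (v := Pi.single a 1 - Pi.single a' 1) (by simp)
  simp only [Matrix.sub_vecMul, Pi.sub_apply, sub_mul, Finset.sum_sub_distrib] at h2
  simp only [Matrix.single_one_vecMul, Pi.single_apply, ite_mul, one_mul, zero_mul,
    Finset.sum_ite_eq', Finset.mem_univ, if_true] at h2
  have h3 := h2.trans (mul_le_mul_of_nonneg_left (hΔ n a a') hK)
  rw [pathMean_sub] at h1
  calc _ ≤ _ := abs_sub_le _ _ _
    _ ≤ K + K * Δ := add_le_add h1 h3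
    _ = _ := by ring

/-- Exponential moments of a Hamming-Lipschitz function of a Markov path whose first state has law
`p`, by applying Hoeffding's lemma to each transition. -/
theorem sum_mul_pathMean_exp_le (hQ : ∀ a b, 0 ≤ Q a b) (hQ1 : ∀ a, ∑ b, Q a b = 1) {K Δ : ℝ}
    (hK : 0 ≤ K) (hΔ0 : 0 ≤ Δ) (hΔ : ∀ (m : ℕ) (a a' : α),
      ∑ s ∈ Finset.range m, ∑ b, |(Q ^ (s + 1)) a b - (Q ^ (s + 1)) a' b| ≤ Δ) {p : α → ℝ}
    (hp : ∀ a, 0 ≤ p a) (hp1 : ∑ a, p a = 1) (n : ℕ)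
    {F : (Fin (n + 1) → α) → ℝ} (hF : ∀ x y, |F x - F y| ≤ ∑ i, if x i ≠ y i then K else 0) :
    ∑ a, p a * pathMean Q n a (fun x => Real.exp (F (Fin.cons a x))) ≤
      Real.exp (∑ a, p a * pathMean Q n a (fun x => F (Fin.cons a x)) +
        (n + 1 : ℕ) * ((K * (1 + Δ)) ^ 2 / 8)) := by
  have step : ∀ a, pathMean Q n a (fun x => Real.exp (F (Fin.cons a x))) ≤
      Real.exp (pathMean Q n a (fun x => F (Fin.cons a x)) + n * ((K * (1 + Δ)) ^ 2 / 8)) := by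
    cases n with
    | zero => simp [pathMean]
    | succ n =>
      exact fun a => sum_mul_pathMean_exp_le hQ hQ1 hK hΔ0 hΔ (hQ a) (hQ1 a) n
        (F := fun x => F (Fin.cons a x)) fun x y => by
          simpa [Fin.sum_univ_succ] using hF (Fin.cons a x) (Fin.cons a y)
  have h1 := abs_pathMean_cons_sub_le hQ hQ1 hK hΔ n hF
  calc ∑ a, p a * pathMean Q n a (fun x => Real.exp (F (Fin.cons a x)))
      ≤ ∑ a, p a * Real.exp (pathMean Q n a (fun x => F (Fin.cons a x)) +
          n * ((K * (1 + Δ)) ^ 2 / 8)) :=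
        Finset.sum_le_sum fun a _ => mul_le_mul_of_nonneg_left (step a) (hp a)
    _ = (∑ a, p a * Real.exp (pathMean Q n a (fun x => F (Fin.cons a x)))) *
          Real.exp (n * ((K * (1 + Δ)) ^ 2 / 8)) := by
        simp only [Real.exp_add, Finset.sum_mul, mul_assoc]
    _ ≤ _ := mul_le_mul_of_nonneg_right (sum_mul_exp_le hp hp1 (by positivity) h1)
        (Real.exp_pos _).le
    _ = _ := by
        rw [← Real.exp_add]
        congr 1
        push_cast
        ring

end path

/-! ### Summability of the mixing coefficients -/

section doeblin

variable {α : Type*} [Fintype α] {Q : Matrix α α ℝ}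

/-- Doeblin's contraction: on vectors of sum zero, the constant `δ` can be subtracted from all
entries of `R`. -/
theorem sum_abs_vecMul_le {R : Matrix α α ℝ} {δ : ℝ} (hR : ∀ a b, δ ≤ R a b)
    (hR1 : ∀ a, ∑ b, R a b = 1) {v : α → ℝ} (hv : ∑ a, v a = 0) :
    ∑ b, |Matrix.vecMul v R b| ≤ (1 - Fintype.card α * δ) * ∑ a, |v a| := by
  have h1 : ∀ b, |Matrix.vecMul v R b| ≤ ∑ a, |v a| * (R a b - δ) := fun b => by
    have : Matrix.vecMul v R b = ∑ a, v a * (R a b - δ) := by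
      simp [Matrix.vecMul, dotProduct, mul_sub, ← Finset.sum_mul, hv]
    rw [this]
    refine (Finset.abs_sum_le_sum_abs _ _).trans (Finset.sum_le_sum fun a _ => ?_)
    rw [abs_mul, abs_of_nonneg (sub_nonneg.2 (hR a b))]
  refine (Finset.sum_le_sum fun b _ => h1 b).trans_eq ?_
  rw [Finset.sum_comm]
  simp only [← Finset.mul_sum, Finset.sum_sub_distrib, hR1]
  simp [← Finset.sum_mul, mul_comm]

variable [DecidableEq α]

theorem sum_pow_apply (hQ1 : ∀ a, ∑ b, Q a b = 1) (t : ℕ) (a : α) : ∑ b, (Q ^ t) a b = 1 := by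
  induction t generalizing a with
  | zero => simp [Matrix.one_apply]
  | succ t ih =>
    simp only [pow_succ, Matrix.mul_apply]
    rw [Finset.sum_comm]
    simp only [← Finset.mul_sum, hQ1, mul_one, ih]

/-- The partial sums `s` satisfy `s ≤ ∑ t < r, a t + c s`. -/
theorem summable_of_add_le_mul {a : ℕ → ℝ} (ha : ∀ t, 0 ≤ a t) {r : ℕ} {c : ℝ} (hc : c < 1)
    (h : ∀ t, a (r + t) ≤ c * a t) : Summable a := by
  refine summable_of_sum_range_le (c := (∑ t ∈ Finset.range r, a t) / (1 - c)) ha fun N => ?_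
  rw [le_div_iff₀ (by linarith)]
  have h1 : ∑ t ∈ Finset.range N, a t ≤ ∑ t ∈ Finset.range (r + N), a t :=
    Finset.sum_le_sum_of_subset_of_nonneg (Finset.range_mono (by omega)) fun t _ _ => ha t
  rw [Finset.sum_range_add] at h1
  have h2 : ∑ t ∈ Finset.range N, a (r + t) ≤ c * ∑ t ∈ Finset.range N, a t := by
    rw [Finset.mul_sum]
    exact Finset.sum_le_sum fun t _ => h t
  linarith

theorem summable_sum_abs_pow_sub_pow (hQ1 : ∀ a, ∑ b, Q a b = 1) {r : ℕ}
    (hr : ∀ a b, 0 < (Q ^ r) a b) (a a' : α) :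
    Summable fun t : ℕ => ∑ b, |(Q ^ t) a b - (Q ^ t) a' b| := by
  have hne : Nonempty α := ⟨a⟩
  obtain ⟨⟨i, j⟩, hij⟩ := Finite.exists_min fun z : α × α => (Q ^ r) z.1 z.2
  set δ := (Q ^ r) i j
  have hδ : ∀ a b, δ ≤ (Q ^ r) a b := fun a b => hij (a, b)
  have hpos : 0 < Fintype.card α * δ := mul_pos (Nat.cast_pos.2 Fintype.card_pos) (hr i j)
  refine summable_of_add_le_mul (r := r) (c := 1 - Fintype.card α * δ)
    (fun t => Finset.sum_nonneg fun b _ => abs_nonneg _) (by linarith) fun t => ?_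
  have h1 := sum_abs_vecMul_le hδ (sum_pow_apply hQ1 r) (v := (Q ^ t) a - (Q ^ t) a') (by
    simp [Finset.sum_sub_distrib, sum_pow_apply hQ1])
  refine le_of_eq_of_le ?_ h1
  refine Finset.sum_congr rfl fun b _ => ?_
  rw [add_comm, pow_add, Matrix.sub_vecMul]
  rfl

end doeblin

/-! ### Hidden Markov models -/

namespace HMMParam

variable {S : ℕ} {𝓨 : Type*} [MeasurableSpace 𝓨]

theorem isProbabilityMeasure_emission (M : HMMParam S 𝓨) (a : Fin S) :
    IsProbabilityMeasure (M.emission a) :=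
  ⟨by rw [emission, withDensity_apply _ MeasurableSet.univ, setLIntegral_univ, M.lintegral_g]⟩

/-- The probability that the hidden path of length `n + 1` is `x`. -/
def pathWeight (M : HMMParam S 𝓨) {n : ℕ} (x : Fin (n + 1) → Fin S) : ℝ :=
  M.init (x 0) * ∏ k : Fin n, M.Q (x k.castSucc) (x k.succ)

theorem pathWeight_nonneg (M : HMMParam S 𝓨) {n : ℕ} (x : Fin (n + 1) → Fin S) :
    0 ≤ M.pathWeight x :=
  mul_nonneg (M.init_nonneg _) (Finset.prod_nonneg fun _ _ => M.Q_nonneg _ _)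

theorem sum_pathWeight_mul (M : HMMParam S 𝓨) {n : ℕ} (F : (Fin (n + 1) → Fin S) → ℝ) :
    ∑ x, M.pathWeight x * F x =
      ∑ a, M.init a * pathMean M.Q n a fun x => F (Fin.cons a x) :=
  sum_prod_mul_eq_sum_pathMean M.Q n M.init F

theorem mixingConst_lt_top (M : HMMParam S 𝓨) {r : ℕ} (hQ : ∀ a b, 0 < (M.Q ^ r) a b) :
    M.mixingConst < ⊤ := by
  have hs : Summable fun t : ℕ => ∑ a, ∑ a', ∑ b, |(M.Q ^ t) a b - (M.Q ^ t) a' b| :=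
    summable_sum fun a _ => summable_sum fun a' _ => summable_sum_abs_pow_sub_pow M.Q_sum hQ a a'
  have hs' := (summable_nat_add_iff 1).2 hs
  refine ENNReal.mul_lt_top (by simp) (lt_of_le_of_lt ?_ hs'.tsum_ofReal_lt_top)
  refine ENNReal.tsum_le_tsum fun t => iSup₂_le fun a a' => ENNReal.ofReal_le_ofReal ?_
  have hnn : ∀ a a', 0 ≤ ∑ b, |(M.Q ^ (t + 1)) a b - (M.Q ^ (t + 1)) a' b| := fun a a' =>
    Finset.sum_nonneg fun _ _ => abs_nonneg _
  calc _ ≤ ∑ a', ∑ b, |(M.Q ^ (t + 1)) a b - (M.Q ^ (t + 1)) a' b| :=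
        Finset.single_le_sum (f := fun a' => ∑ b, |(M.Q ^ (t + 1)) a b - (M.Q ^ (t + 1)) a' b|)
          (fun a' _ => hnn a a') (Finset.mem_univ a')
    _ ≤ _ := Finset.single_le_sum
          (f := fun a => ∑ a', ∑ b, |(M.Q ^ (t + 1)) a b - (M.Q ^ (t + 1)) a' b|)
          (fun a _ => Finset.sum_nonneg fun a' _ => hnn a a') (Finset.mem_univ a)

theorem sum_range_sum_abs_le (M : HMMParam S 𝓨) (h : M.mixingConst < ⊤) (m : ℕ)
    (a a' : Fin S) :
    ∑ s ∈ Finset.range m, ∑ b, |(M.Q ^ (s + 1)) a b - (M.Q ^ (s + 1)) a' b| ≤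
      2 * M.mixingConst.toReal := by
  set T := ∑' t : ℕ, ⨆ (a : Fin S) (a' : Fin S),
    ENNReal.ofReal (∑ b, |(M.Q ^ (t + 1)) a b - (M.Q ^ (t + 1)) a' b|) with hT
  have hD : M.mixingConst = 1 / 2 * T := rfl
  have hTtop : T ≠ ⊤ := fun hT => by
    rw [hD, hT, ENNReal.mul_top (by simp)] at h
    exact lt_irrefl _ h
  have h2 : 2 * M.mixingConst.toReal = T.toReal := by
    rw [hD, ENNReal.toReal_mul]
    simp
  rw [h2, ← ENNReal.ofReal_le_iff_le_toReal hTtop, ENNReal.ofReal_sum_of_nonneg fun s _ =>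
    Finset.sum_nonneg fun b _ => abs_nonneg _]
  refine le_trans (Finset.sum_le_sum fun s _ => ?_) (ENNReal.sum_le_tsum (Finset.range m))
  exact le_iSup₂ (f := fun a a' : Fin S =>
    ENNReal.ofReal (∑ b, |(M.Q ^ (s + 1)) a b - (M.Q ^ (s + 1)) a' b|)) a a'

/-- The defining law of the model, with time indexed by `Fin (n + 1)`. -/
theorem IsHMM.measure_path_inter {M : HMMParam S 𝓨} {Ω : Type*} [MeasurableSpace Ω]
    {P : Measure Ω} {X : ℕ → Ω → Fin S} {Y : ℕ → Ω → 𝓨} (hXY : M.IsHMM P X Y) {n : ℕ}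
    (x : Fin (n + 1) → Fin S) {A : Fin (n + 1) → Set 𝓨} (hA : ∀ i, MeasurableSet (A i)) :
    P {ω | ∀ i : Fin (n + 1), X i ω = x i ∧ Y i ω ∈ A i} =
      ENNReal.ofReal (M.pathWeight x) * ∏ i, M.emission (x i) (A i) := by
  have h := hXY.law n (fun k => if h : k < n + 1 then x ⟨k, h⟩ else x 0)
    (fun k => if h : k < n + 1 then A ⟨k, h⟩ else Set.univ) fun k => by
      split_ifs
      exacts [hA _, MeasurableSet.univ]
  convert h using 2
  · ext ω
    simp only [Set.mem_ofPred_eq]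
    constructor
    · intro hω k hk
      simpa [Nat.lt_succ_of_le hk] using hω ⟨k, Nat.lt_succ_of_le hk⟩
    · intro hω i
      simpa [Nat.le_of_lt_succ i.2] using hω i (Nat.le_of_lt_succ i.2)
  · rw [pathWeight, Finset.prod_range]
    congr 2
    refine Finset.prod_congr rfl fun k _ => ?_
    have h1 : (k : ℕ) < n + 1 := k.2.trans (Nat.lt_succ_self n)
    simp only [h1, Nat.add_lt_add_right k.2 1, dif_pos]
    rfl
  · rw [Finset.prod_range]
    refine Finset.prod_congr rfl fun i _ => ?_
    simp [emission, withDensity_apply _ (hA i), Nat.le_of_lt_succ i.2]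

/-- The law of the first `n + 1` observations is a mixture of products of emission laws. -/
theorem IsHMM.map_eq_sum {M : HMMParam S 𝓨} {Ω : Type*} [MeasurableSpace Ω]
    {P : Measure Ω} [IsProbabilityMeasure P] {X : ℕ → Ω → Fin S} {Y : ℕ → Ω → 𝓨}
    (hXY : M.IsHMM P X Y) (n : ℕ) :
    P.map (fun ω (i : Fin (n + 1)) => Y i ω) =
      ∑ x : Fin (n + 1) → Fin S,
        ENNReal.ofReal (M.pathWeight x) • Measure.pi fun i => M.emission (x i) := by
  have := M.isProbabilityMeasure_emission
  have hYm : Measurable fun ω (i : Fin (n + 1)) => Y i ω :=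
    measurable_pi_lambda _ fun i => hXY.measurable_Y i
  have hXm : Measurable fun ω (i : Fin (n + 1)) => X i ω :=
    measurable_pi_lambda _ fun i => hXY.measurable_X i
  have hbox : ∀ A : Fin (n + 1) → Set 𝓨, (∀ i, MeasurableSet (A i)) →
      P.map (fun ω (i : Fin (n + 1)) => Y i ω) (Set.univ.pi A) =
        (∑ x : Fin (n + 1) → Fin S,
          ENNReal.ofReal (M.pathWeight x) • Measure.pi fun i => M.emission (x i))
            (Set.univ.pi A) := fun A hA => by
    have hAm : MeasurableSet (Set.univ.pi A) := MeasurableSet.univ_pi hA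
    rw [Measure.map_apply hYm hAm]
    simp only [Measure.finsetSum_apply, Measure.smul_apply, Measure.pi_pi, smul_eq_mul]
    have h1 := sum_measure_preimage_singleton
      (μ := P.restrict ((fun ω (i : Fin (n + 1)) => Y i ω) ⁻¹' Set.univ.pi A))
      (Finset.univ : Finset (Fin (n + 1) → Fin S)) (f := fun ω (i : Fin (n + 1)) => X i ω)
      fun x _ => hXm (measurableSet_singleton x)
    rw [Finset.coe_univ, Set.preimage_univ, Measure.restrict_apply_univ] at h1
    rw [← h1]
    refine Finset.sum_congr rfl fun x _ => ?_
    rw [Measure.restrict_apply (hXm (measurableSet_singleton x)), ← hXY.measure_path_inter x hA]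
    congr 1
    ext ω
    simp [funext_iff, forall_and]
  refine ext_of_generate_finite _ generateFrom_pi.symm isPiSystem_pi ?_ ?_
  · rintro _ ⟨A, hA, rfl⟩
    exact hbox A fun i => hA i (Set.mem_univ i)
  · simpa using hbox (fun _ => Set.univ) fun _ => MeasurableSet.univ

theorem IsHMM.integral_map {M : HMMParam S 𝓨} {Ω : Type*} [MeasurableSpace Ω]
    {P : Measure Ω} [IsProbabilityMeasure P] {X : ℕ → Ω → Fin S} {Y : ℕ → Ω → 𝓨}
    (hXY : M.IsHMM P X Y) {n : ℕ} {f : (Fin (n + 1) → 𝓨) → ℝ} (hf : Measurable f)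
    (hb : ∃ b, ∀ u, |f u| ≤ b) :
    ∫ u, f u ∂P.map (fun ω (i : Fin (n + 1)) => Y i ω) =
      ∑ x : Fin (n + 1) → Fin S,
        M.pathWeight x * ∫ u, f u ∂Measure.pi fun i => M.emission (x i) := by
  have := M.isProbabilityMeasure_emission
  rw [hXY.map_eq_sum, integral_finsetSum_measure fun x _ =>
    (integrable_of_abs_le hf hb).smul_measure ENNReal.ofReal_ne_top]
  simp [integral_smul_measure, M.pathWeight_nonneg]

end HMMParam

section

variable {S : ℕ} {𝓨 : Type*} [MetricSpace 𝓨] [TopologicalSpace.SeparableSpace 𝓨]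
  [MeasurableSpace 𝓨] [BorelSpace 𝓨]

/-- The sub-Gaussian bound for the law of `n + 1` observations. The constant `L` bounds the
discrepancy between two emission laws on `1`-Lipschitz functions. -/
theorem HMMParam.IsHMM.lipSubgaussian_map {M : HMMParam S 𝓨} {Ω : Type*} [MeasurableSpace Ω]
    {P : Measure Ω} [IsProbabilityMeasure P] {X : ℕ → Ω → Fin S} {Y : ℕ → Ω → 𝓨}
    (hXY : M.IsHMM P X Y) (hD : M.mixingConst < ⊤) {C L : ℝ} (hL0 : 0 ≤ L)
    (hC : ∀ a, LipSubgaussian (fun y y' : 𝓨 => dist y y') C (M.emission a))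
    (hL : ∀ a b (K : ℝ) (f : 𝓨 → ℝ), 0 ≤ K → (∀ u v, |f u - f v| ≤ K * dist u v) →
      (∃ c, ∀ u, |f u| ≤ c) → |∫ y, f y ∂M.emission a - ∫ y, f y ∂M.emission b| ≤
        if a ≠ b then K * L else 0) (n : ℕ) :
    LipSubgaussian l1Dist ((n + 1 : ℕ) * (C + L ^ 2 * (1 + 2 * M.mixingConst.toReal) ^ 2 / 4))
      (P.map fun ω (i : Fin (n + 1)) => Y i ω) := by
  intro K f hK hf hb
  have := M.isProbabilityMeasure_emission
  set D := M.mixingConst.toReal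
  have hD0 : 0 ≤ D := ENNReal.toReal_nonneg
  have hfm := measurable_of_abs_sub_le_l1Dist hK hf
  let F : (Fin (n + 1) → Fin S) → ℝ := fun x => ∫ u, f u ∂Measure.pi fun i => M.emission (x i)
  have hF : ∀ x y, |F x - F y| ≤ ∑ i, if x i ≠ y i then K * L else 0 := fun x y =>
    abs_integral_pi_sub_integral_pi_le hK (fun i => M.emission (x i)) (fun i => M.emission (y i))
      _ (fun i g hg hgb => hL (x i) (y i) K g hK hg hgb) hf hb
  have hmgf := sum_mul_pathMean_exp_le M.Q_nonneg M.Q_sum (mul_nonneg hK hL0)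
    (mul_nonneg zero_le_two hD0) (M.sum_range_sum_abs_le hD) M.init_nonneg M.init_sum n hF
  rw [← M.sum_pathWeight_mul (fun x => Real.exp (F x)), ← M.sum_pathWeight_mul F] at hmgf
  rw [hXY.integral_map hfm.exp (exists_abs_exp_le hb), hXY.integral_map hfm hb]
  calc ∑ x, M.pathWeight x * ∫ u, Real.exp (f u) ∂Measure.pi (fun i => M.emission (x i))
      ≤ ∑ x, M.pathWeight x * Real.exp (F x + (n + 1 : ℕ) * C * K ^ 2 / 2) :=
        Finset.sum_le_sum fun x _ => mul_le_mul_of_nonneg_left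
          (LipSubgaussian.pi (fun i => M.emission (x i)) (fun i => hC (x i)) K f hK hf hb)
          (M.pathWeight_nonneg x)
    _ = (∑ x, M.pathWeight x * Real.exp (F x)) * Real.exp ((n + 1 : ℕ) * C * K ^ 2 / 2) := by
        simp only [Real.exp_add, Finset.sum_mul, mul_assoc]
    _ ≤ _ := mul_le_mul_of_nonneg_right hmgf (Real.exp_pos _).le
    _ = _ := by
        rw [← Real.exp_add]
        congr 1
        simp only [F, D]
        ring

theorem satisfiesT1_l1Dist_of_lipSubgaussian {n : ℕ} {ρ : Measure (Fin n → 𝓨)}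
    [IsProbabilityMeasure ρ] {C : ℝ} (hC : 0 < C) (h : LipSubgaussian l1Dist C ρ) :
    SatisfiesT1 l1Dist C ρ := by
  have : SecondCountableTopology 𝓨 := UniformSpace.secondCountable_of_separable 𝓨
  have hcont : Continuous fun z : (Fin n → 𝓨) × (Fin n → 𝓨) => l1Dist z.1 z.2 :=
    continuous_l1Dist
  refine LipSubgaussian.satisfiesT1 (E := Fin n → 𝓨) (d := l1Dist) (K := n) l1Dist_self l1Dist_comm
    l1Dist_triangle ?_ ?_ ?_ hC h
  · exact hcont
  · exact l1Dist_le_mul_dist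
  · exact dist_le_l1Dist

end

theorem theorem2p2 {S : ℕ} {𝓨 : Type*} [MetricSpace 𝓨] [TopologicalSpace.SeparableSpace 𝓨]
    [MeasurableSpace 𝓨] [BorelSpace 𝓨] (M : HMMParam S 𝓨)
    {Ω : Type*} [MeasurableSpace Ω] (P : Measure Ω) [IsProbabilityMeasure P]
    (X : ℕ → Ω → Fin S) (Y : ℕ → Ω → 𝓨) (hXY : M.IsHMM P X Y)
    (r : ℕ) (hr : 0 < r) (hQ : ∀ a b, 0 < (M.Q ^ r) a b) :
    M.mixingConst < ⊤ ∧
    (Countable 𝓨 → (∀ y y' : 𝓨, dist y y' ≤ 1) →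
      ∀ n : ℕ, 1 ≤ n →
        SatisfiesT1 l1Dist (n * (M.mixingConst.toReal + 1) ^ 2)
          (P.map fun ω (i : Fin n) => Y i ω)) ∧
    (∀ C_Y L : ℝ, 0 < L →
      (∀ a, SatisfiesT1 (fun y y' : 𝓨 => dist y y') C_Y (M.emission a)) →
      (∀ a b, transportCost (fun y y' : 𝓨 => dist y y') (M.emission a) (M.emission b) ≤
        ENNReal.ofReal (L * if a ≠ b then 1 else 0)) →
      ∀ n : ℕ, 1 ≤ n →
        SatisfiesT1 l1Dist (n * (C_Y + L ^ 2 * (M.mixingConst.toReal + 1) ^ 2))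
          (P.map fun ω (i : Fin n) => Y i ω)) := by
  have := M.isProbabilityMeasure_emission
  have hD := M.mixingConst_lt_top hQ
  have hD0 : 0 ≤ M.mixingConst.toReal := ENNReal.toReal_nonneg
  have hprob : ∀ n : ℕ, IsProbabilityMeasure (P.map fun ω (i : Fin n) => Y i ω) := fun n =>
    Measure.isProbabilityMeasure_map
      (measurable_pi_lambda _ fun i : Fin n => hXY.measurable_Y i).aemeasurable
  refine ⟨hD, fun _ hd n hn => ?_, fun C L hL hT hW n hn => ?_⟩
  · obtain ⟨n, rfl⟩ := Nat.exists_eq_add_of_le' hn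
    refine satisfiesT1_l1Dist_of_lipSubgaussian (by positivity) ?_
    refine (hXY.lipSubgaussian_map hD zero_le_one
      (fun a => lipSubgaussian_of_dist_le_one hd (M.emission a)) (fun a b K f hK hf hb => ?_)
      n).mono ?_
    · split_ifs with hab
      · have hfm := measurable_of_abs_sub_le hf
        have hosc : ∀ x y, |f x - f y| ≤ K := fun x y =>
          (hf x y).trans (mul_le_of_le_one_right hK (hd x y))
        have h1 : ∀ x, |f x - ∫ y, f y ∂M.emission b| ≤ K := fun x => by
          simpa using abs_integral_sub_integral_le (ρ := M.emission b) (integrable_const (f x))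
            (integrable_of_abs_le hfm hb) (hosc x)
        simpa using abs_integral_sub_integral_le (ρ := M.emission a)
          (integrable_of_abs_le hfm hb) (integrable_const (∫ y, f y ∂M.emission b)) h1
      · simp [not_not.1 hab]
    · refine mul_le_mul_of_nonneg_left ?_ (Nat.cast_nonneg _)
      nlinarith
  · obtain ⟨n, rfl⟩ := Nat.exists_eq_add_of_le' hn
    obtain ⟨ω⟩ : Nonempty Ω := P.nonempty_of_neZero
    have hC : 0 < C := (hT (X 0 ω)).1
    refine satisfiesT1_l1Dist_of_lipSubgaussian (by positivity) ?_
    refine (hXY.lipSubgaussian_map hD hL.le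
      (fun a => (hT a).lipSubgaussian fun f K hf => measurable_of_abs_sub_le hf)
      (fun a b K f hK hf hb => ?_) n).mono ?_
    · refine (abs_integral_sub_integral_le_of_transportCost_le (hW a b) (by positivity) hK hf
        (measurable_of_abs_sub_le hf) hb).trans_eq ?_
      split_ifs <;> ring
    · refine mul_le_mul_of_nonneg_left ?_ (Nat.cast_nonneg _)
      have h1 : 0 ≤ L ^ 2 * (M.mixingConst.toReal + 3 / 4) := by positivity
      nlinarith
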